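/- **Setting.** Let $G=(V,E)$ be a finite connected undirected graph with edge weights $w>0$ and shortest-path distance $d_G$. There are $N\ge 1$ robots and $M$ tasks, and $f_i^j:\mathbb R\to\mathbb R$ is strictly increasing for each robot $i$ and task $j$. For a demand $\Phi=(\phi^j(v))_{v\in V,\,j\le M}$, a configuration $\eta\in V^N$ and coverings $P=(P_i^j)$ of $V$ ($\bigcup_i P_i^j=V$ for all $j$), put $$\mathcal H(\eta,P)=\sum_{j}\sum_{i}\sum_{v\in P_i^j} f_i^j(d_G(\eta_i,v))\,\phi^j(v),\qquad \mathcal H_{\inf}(\eta,\Phi)=\sum_j\sum_{v\in V}\Big(\min_{i} f_i^j(d_G(\eta_i,v))\Big)\phi^j(v).$$ Multitask centers $c(P)$ satisfy $c_i(P)\in\arg\min_{x\in V}\sum_j\sum_{v\in P_i^j}f_i^j(d_G(x,v))\phi^j(v)$. Fix a tie-breaking rule which chooses, for all $\eta,j,v$, one robot $b(\eta,j,v)\in\arg\min_i f_i^j(d_G(\eta_i,v))$. The equitable partitions are $\mathcal V(\eta)_i^j=\{v: b(\eta,j,v)=i\}$. The instantaneous regret of $(\eta_t,P_t)$ is $$\mathcal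 R_t(\Phi)=2\mathcal H(\eta_t,P_t)-\mathcal H(c(P_t),P_t)-\mathcal H(\eta_t,\mathcal V(\eta_t)).$$ **Demand and samples.** The vertices have positions in a compact convex set $D\subset\mathbb R^2$. The demand has the prior $\Phi\sim\mathcal N(\tilde\mu_0,\Sigma_0\otimes K)$, where $\Sigma_0$ is the squared-exponential covariance $k(v,v')=\sigma_v^2\exp(-d_{\rm eu}(v,v')^2/(2\lambda^2))$, $\sigma_v,\lambda>0$, and $K$ is positive semidefinite. The $k$-th sample, taken at $v_{s_k}$, is $y_k=\Phi(v_{s_k})+\epsilon_k$ with $\epsilon_k\sim\mathcal N(0,\sigma^2I_M)$, $\sigma>0$, independent of each other and of $\Phi$. $\tilde\mu(k)$ and $\tilde\Sigma(k)$ denote the Gaussian posterior mean and covariance after $k$ samples, and $\tilde\Sigma_v(k)$ the $M\times M$ diagonal block of $\tilde\Sigma(k)$ at $v$. The sampling points are greedy: $s_{k+1}\in\arg\max_{v}\det(I_M+\sigma^{-2}\tilde\Sigma_v(k))$. Let $\tau$ satisfy $\operatorname{tr}\tilde\Sigma_v(0)\le\tau$ for all $v$. **Communication.** Time is slotted. In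 each slot at most one robot communicates with the base station, and for each robot the time between consecutive communications is at least $l>0$ and at most $u>l$. **DSMLC.** Parameters $\beta>1$ and $\alpha\in(0,1)$. Epoch $\ell=1,2,\dots$ consists of three phases. 1. *Exploration.* Greedy sampling points are added until $\max_v\operatorname{tr}\tilde\Sigma_v(k)\le\alpha^\ell\tau$. Each new point is assigned to a robot whose current multitask center (for the current estimate; the prior mean in the first epoch) is nearest, and is visited by that robot; the phase lasts at most $\rho$ slots per new sampling point, for a constant $\rho$. 2. *Information propagation.* This lasts until every robot has communicated; then $\hat\Phi=\tilde\mu$. 3. *Coverage*, for $\lceil\beta^\ell\rceil$ slots. If robot $i$ communicates in the slot and $\mathcal H_{\inf}(\cdot,\hat\Phi)$ can be strictly decreased by changing $\eta_i$ alone, then $\eta_i$ is moved to a minimizer; afterwards, for each $j$, $P_i^j\leftarrow(P_i^j\setminus P_{i,-}^j)\cup P_{i,+}^j$, where $P_{i,+}^j=\{v:b(\eta,j,v)=i\}$ and $P_{i,-}^j=\{v\in P_i^j\cap\bigcup_{i'\ne i}P_{i'}^j:\ b(\eta,j,v)\ne i\}$. If no robot communicates, nothing changes. The coverings are unchanged in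 phases 1 and 2; the initial one is arbitrary. **Theorem.** If $\alpha=\beta^{-2/3}$, then, in expectation given that the demand is nonnegative, the cumulative multitask coverage regret of DSMLC is integrable for every horizon $T$ and satisfies, as $T\to\infty$, $$\mathbb E\Big[\sum_{t=1}^T\mathcal R_t(\Phi)\ \Big|\ \phi^j(v)\ge 0\ \text{ for all } v,j\Big]\in O\big(T^{2/3}(\log T)^3\big).$$ -/

import Mathlib

namespace MultitaskCoverage

noncomputable section

open scoped Kronecker

/-- A weighted connected graph environment on the vertex set `V`, with `N` robots and `M` tasks.
`f i j` is the (strictly increasing) service cost of robot `i` on task `j` as a function of the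
graph distance. -/
structure Environment (V : Type*) (N M : ℕ) where
  G : SimpleGraph V
  connected : G.Connected
  w : Sym2 V → ℝ
  w_pos : ∀ e ∈ G.edgeSet, 0 < w e
  f : Fin N → Fin M → ℝ → ℝ
  f_strictMono : ∀ i j, StrictMono (f i j)

/-- Demand functions `φ^j(v)`, written `Φ v j`. -/
abbrev Demand (V : Type*) (M : ℕ) := V → Fin M → ℝ

/-- Robot team configurations `η`. -/
abbrev Config (V : Type*) (N : ℕ) := Fin N → V

/-- Collections of sets `P j i` (vertices at which robot `i` services task `j`). -/
abbrev Coverings (V : Type*) (N M : ℕ) := Fin M → Fin N → Finset V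

/-- Each `P j` is an `N`-covering of `V`. -/
def IsCovering {V : Type*} {N M : ℕ} (P : Coverings V N M) : Prop :=
  ∀ j v, ∃ i, v ∈ P j i

namespace Environment

variable {V : Type*} {N M : ℕ}

/-- Weighted graph distance: the minimal total weight of a walk. -/
def gdist (env : Environment V N M) (u v : V) : ℝ :=
  ⨅ p : env.G.Walk u v, (p.edges.map env.w).sum

/-- Cost of servicing task `j` at `v` by robot `i` located at `x`. -/
def service (env : Environment V N M) (i : Fin N) (j : Fin M) (x v : V) : ℝ :=
  env.f i j (env.gdist x v)

/-- Multitask coverage cost. -/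
def cost (env : Environment V N M) (Φ : Demand V M) (η : Config V N) (P : Coverings V N M) : ℝ :=
  ∑ j, ∑ i, ∑ v ∈ P j i, env.service i j (η i) v * Φ v j

/-- The part of the coverage cost incurred by robot `i` when it sits at `c`. -/
def robotCost (env : Environment V N M) (Φ : Demand V M) (P : Coverings V N M) (i : Fin N)
    (c : V) : ℝ :=
  ∑ j, ∑ v ∈ P j i, env.service i j c v * Φ v j

/-- `c` is a vector of multitask centers of `P` for the demand `Φ`. -/
def IsCenters (env : Environment V N M) (Φ : Demand V M) (P : Coverings V N M)
    (c : Config V N) : Prop :=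
  ∀ i x, env.robotCost Φ P i (c i) ≤ env.robotCost Φ P i x

theorem exists_isCenters [Finite V] (env : Environment V N M) (Φ : Demand V M) (P : Coverings V N M) :
    ∃ c, env.IsCenters Φ P c := by
  have := env.connected.nonempty
  choose c hc using fun i => Finite.exists_min (env.robotCost Φ P i)
  exact ⟨c, hc⟩

/-- Multitask centers `c(P)` (some choice of them; the cost at the centers does not depend on the
choice). -/
def centers [Finite V] (env : Environment V N M) (Φ : Demand V M) (P : Coverings V N M) : Config V N :=
  (env.exists_isCenters Φ P).choose

variable [Fintype V]

/-- The cost `H_inf`: every task at every vertex is serviced by a best robot. -/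
def costInf (env : Environment V N M) (Φ : Demand V M) (η : Config V N) : ℝ :=
  ∑ j, ∑ v, (⨅ i, env.service i j (η i) v) * Φ v j

/-- A tie-breaking rule: for each configuration, task and vertex it names one robot among those
with the smallest service cost. -/
structure TieBreak (env : Environment V N M) where
  best : Config V N → Fin M → V → Fin N
  best_le : ∀ η j v i,
    env.service (best η j v) j (η (best η j v)) v ≤ env.service i j (η i) v

/-- Multitask equitable partitions of `η`, with ties broken by `tb`. -/
def equitable {env : Environment V N M} (tb : env.TieBreak) (η : Config V N) :
    Coverings V N M :=
  fun j i => {v | tb.best η j v = i}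

/-- Instantaneous multitask coverage regret
`2 H(η, P) - H(c(P), P) - H(η, 𝒱(η))` for the demand `Φ`. -/
def regret {env : Environment V N M} (tb : env.TieBreak) (Φ : Demand V M) (η : Config V N)
    (P : Coverings V N M) : ℝ :=
  2 * env.cost Φ η P - env.cost Φ (env.centers Φ P) P - env.cost Φ η (equitable tb η)

variable [DecidableEq V]

/-- The vertices that robot `i` gains for task `j`: those best served by robot `i` at `η`. When no
other robot ties with the best one, this says that the service cost of `i` is strictly smaller
than that of every other robot. -/
def gain {env : Environment V N M} (tb : env.TieBreak) (η : Config V N) (j : Fin M) (i : Fin N) :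
    Finset V :=
  {v | tb.best η j v = i}

/-- The vertices that robot `i` drops for task `j`: those also owned by another robot and not best
served by robot `i`. -/
def loss {env : Environment V N M} (tb : env.TieBreak) (η : Config V N) (P : Coverings V N M)
    (j : Fin M) (i : Fin N) : Finset V :=
  {v ∈ P j i | (∃ i', i' ≠ i ∧ v ∈ P j i') ∧ tb.best η j v ≠ i}

/-- One call of the federated multitask coverage algorithm with demand `Φ`, for the robot `i` that
communicates with the base station: `η i` is moved to a minimizer of `H_inf` over the position of
robot `i`, but only if this strictly decreases `H_inf`; then the sets of robot `i` are updated. -/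
def FMCUpdate {env : Environment V N M} (tb : env.TieBreak) (Φ : Demand V M) (i : Fin N)
    (η : Config V N) (P : Coverings V N M) (η' : Config V N) (P' : Coverings V N M) : Prop :=
  (∃ x : V, η' = Function.update η i x ∧
    (∀ v, env.costInf Φ (Function.update η i x) ≤ env.costInf Φ (Function.update η i v)) ∧
    (env.costInf Φ η ≤ env.costInf Φ (Function.update η i x) → x = η i)) ∧
  ∀ j, P' j = Function.update (P j) i ((P j i \ loss tb η' P j i) ∪ gain tb η' j i)

/-- One time slot of the coverage phase: if a robot communicates, the base station runs the
coverage algorithm for it; otherwise nothing changes. -/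
def FMCStep {env : Environment V N M} (tb : env.TieBreak) (Φ : Demand V M)
    (comm : Option (Fin N)) (η : Config V N) (P : Coverings V N M) (η' : Config V N)
    (P' : Coverings V N M) : Prop :=
  (comm = none → η' = η ∧ P' = P) ∧ ∀ i, comm = some i → FMCUpdate tb Φ i η P η' P'

end Environment

/-- Federated communication: `comm t` is the robot (at most one) that communicates with the base
station in slot `t`; for every robot the time between consecutive communications is at least `l`
and at most `u`. -/
structure IsFederated {N : ℕ} (l u : ℕ) (comm : ℕ → Option (Fin N)) : Prop where
  l_pos : 0 < l
  l_lt_u : l < u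
  gap_ge : ∀ i t t', t < t' → comm t = some i → comm t' = some i → l ≤ t' - t
  gap_le : ∀ i t, ∃ t', t < t' ∧ t' ≤ t + u ∧ comm t' = some i

section Estimation

variable {V : Type*} [Fintype V] [DecidableEq V] {M : ℕ}

/-- Squared-exponential covariance of vertices at positions `pos` in the plane. -/
def seKernel (pos : V → EuclideanSpace ℝ (Fin 2)) (σv len : ℝ) : Matrix V V ℝ :=
  Matrix.of fun v v' => σv ^ 2 * Real.exp (-(dist (pos v) (pos v') ^ 2 / (2 * len ^ 2)))

/-- Number of the first `k` samples that are taken at `v`. -/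
def sampleCount (s : ℕ → V) (k : ℕ) (v : V) : ℕ :=
  ((Finset.range k).filter fun m => s m = v).card

/-- The precision `∑ᵥ (nᵥ / σ²) eᵥ eᵥᵀ ⊗ I_M` contributed by the first `k` samples. -/
def samplePrecision (M : ℕ) (σ : ℝ) (s : ℕ → V) (k : ℕ) :
    Matrix (V × Fin M) (V × Fin M) ℝ :=
  (Matrix.diagonal fun v => (sampleCount s k v : ℝ) / σ ^ 2) ⊗ₖ (1 : Matrix (Fin M) (Fin M) ℝ)

/-- Posterior covariance after the first `k` samples of the prior covariance `S`. The form
`(1 + S D)⁻¹ S` of `(S⁻¹ + D)⁻¹` also makes sense for a singular `S`. -/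
def postCov (S : Matrix (V × Fin M) (V × Fin M) ℝ) (σ : ℝ) (s : ℕ → V) (k : ℕ) :
    Matrix (V × Fin M) (V × Fin M) ℝ :=
  (1 + S * samplePrecision M σ s k)⁻¹ * S

/-- The vector `∑ᵥ eᵥ ⊗ (sum of the samples at v) / σ²` for the first `k` samples. -/
def sampleSum (σ : ℝ) (s : ℕ → V) (y : ℕ → Fin M → ℝ) (k : ℕ) : V × Fin M → ℝ :=
  fun p => (∑ m ∈ (Finset.range k).filter (fun m => s m = p.1), y m p.2) / σ ^ 2

/-- Posterior mean after the first `k` samples `y 0, …, y (k - 1)`, taken at `s 0, …, s (k - 1)`,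
for the prior mean `μ₀` and prior covariance `S`. -/
def postMean (μ₀ : V × Fin M → ℝ) (S : Matrix (V × Fin M) (V × Fin M) ℝ) (σ : ℝ) (s : ℕ → V)
    (y : ℕ → Fin M → ℝ) (k : ℕ) : V × Fin M → ℝ :=
  (1 + S * samplePrecision M σ s k)⁻¹.mulVec (μ₀ + S.mulVec (sampleSum σ s y k))

theorem postCov_eq (S : Matrix (V × Fin M) (V × Fin M) ℝ) (hS : IsUnit S.det) (σ : ℝ)
    (s : ℕ → V) (k : ℕ) : postCov S σ s k = (S⁻¹ + samplePrecision M σ s k)⁻¹ := by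
  have h : S⁻¹ + samplePrecision M σ s k = S⁻¹ * (1 + S * samplePrecision M σ s k) := by
    rw [mul_add, mul_one, ← mul_assoc, Matrix.nonsing_inv_mul S hS, one_mul]
  rw [h, Matrix.mul_inv_rev, Matrix.nonsing_inv_nonsing_inv S hS, postCov]

theorem postMean_eq (μ₀ : V × Fin M → ℝ) (S : Matrix (V × Fin M) (V × Fin M) ℝ)
    (hS : IsUnit S.det) (σ : ℝ) (s : ℕ → V) (y : ℕ → Fin M → ℝ) (k : ℕ) :
    postMean μ₀ S σ s y k =
      (postCov S σ s k).mulVec (S⁻¹.mulVec μ₀ + sampleSum σ s y k) := by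
  rw [postMean, postCov, ← Matrix.mulVec_mulVec, Matrix.mulVec_add S, Matrix.mulVec_mulVec,
    Matrix.mul_nonsing_inv S hS, Matrix.one_mulVec]

/-- The `M × M` diagonal block of a covariance matrix at the vertex `v`. -/
def block (C : Matrix (V × Fin M) (V × Fin M) ℝ) (v : V) : Matrix (Fin M) (Fin M) ℝ :=
  C.submatrix (fun j => (v, j)) (fun j => (v, j))

/-- `s` is a greedy sampling sequence: each sample maximizes the one-step mutual information. -/
def IsGreedy (S : Matrix (V × Fin M) (V × Fin M) ℝ) (σ : ℝ) (s : ℕ → V) : Prop :=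
  ∀ k v, (1 + (σ ^ 2)⁻¹ • block (postCov S σ s k) v).det ≤
    (1 + (σ ^ 2)⁻¹ • block (postCov S σ s k) (s k)).det

/-- Total number of samples taken by the end of epoch `ℓ`: in epoch `ℓ` one samples until the
trace of the posterior covariance at every vertex is at most `α ^ ℓ * τ`. -/
def sampleTotal (S : Matrix (V × Fin M) (V × Fin M) ℝ) (σ : ℝ) (s : ℕ → V) (α τ : ℝ) : ℕ → ℕ
  | 0 => 0
  | ℓ + 1 => sInf {k | sampleTotal S σ s α τ ℓ ≤ k ∧
      ∀ v, (block (postCov S σ s k) v).trace ≤ α ^ (ℓ + 1) * τ}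

end Estimation

/-- A run of DSMLC. `est ℓ` is the demand estimate at the end of the exploration of epoch `ℓ`
(`est 0` is the prior mean), `s` the sequence of sampling points, `n ℓ` the number of samples taken
by the end of epoch `ℓ`. Epochs are numbered from `1`; the fields for epoch `ℓ + 1` carry the
index `ℓ`. Its exploration phase consists of the slots in `(tExp ℓ, tInf ℓ]`, its information
propagation phase of those in `(tInf ℓ, tCov ℓ]`, and its coverage phase of those in
`(tCov ℓ, tExp (ℓ + 1)]`. Routing and travel take at most `ρ` slots per sampling point. The robots'
positions are otherwise unconstrained while they explore and report. -/
structure DSMLCRun {V : Type*} [Fintype V] [DecidableEq V] {N M : ℕ} {env : Environment V N M}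
    (tb : env.TieBreak) (l u ρ : ℕ) (β : ℝ) (s : ℕ → V) (n : ℕ → ℕ) (est : ℕ → Demand V M) where
  comm : ℕ → Option (Fin N)
  comm_federated : IsFederated l u comm
  η : ℕ → Config V N
  P : ℕ → Coverings V N M
  covering_zero : IsCovering (P 0)
  tExp : ℕ → ℕ
  tInf : ℕ → ℕ
  tCov : ℕ → ℕ
  tExp_zero : tExp 0 = 0
  /-- duration of the exploration phase -/
  tExp_le_tInf : ∀ ℓ, tExp ℓ ≤ tInf ℓ
  tInf_le : ∀ ℓ, tInf ℓ ≤ tExp ℓ + ρ * (n (ℓ + 1) - n ℓ)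
  /-- each sampling point is assigned to a robot whose current multitask center is nearest -/
  assign : ℕ → Fin N
  assign_nearest : ∀ ℓ, ∃ c, env.IsCenters (est ℓ) (P (tExp ℓ)) c ∧
    ∀ k, n ℓ ≤ k → k < n (ℓ + 1) →
      ∀ i, env.gdist (c (assign k)) (s k) ≤ env.gdist (c i) (s k)
  /-- the assigned robot visits the sampling point during the exploration phase, and takes at most
  one sample per slot -/
  visit : ℕ → ℕ
  visit_mem : ∀ ℓ k, n ℓ ≤ k → k < n (ℓ + 1) → tExp ℓ < visit k ∧ visit k ≤ tInf ℓ
  visit_at : ∀ ℓ k, n ℓ ≤ k → k < n (ℓ + 1) → η (visit k) (assign k) = s k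
  visit_inj : ∀ ℓ k k', n ℓ ≤ k → k < n (ℓ + 1) → n ℓ ≤ k' → k' < n (ℓ + 1) →
    visit k = visit k' → assign k = assign k' → k = k'
  /-- information propagation ends as soon as every robot has communicated -/
  tCov_isLeast : ∀ ℓ, IsLeast {t | tInf ℓ ≤ t ∧ ∀ i, ∃ t', tInf ℓ < t' ∧ t' ≤ t ∧
    comm t' = some i} (tCov ℓ)
  /-- the coverings do not change outside the coverage phases -/
  P_const : ∀ ℓ t, tExp ℓ ≤ t → t < tCov ℓ → P (t + 1) = P t
  /-- duration of the coverage phase -/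
  tExp_succ : ∀ ℓ, tExp (ℓ + 1) = tCov ℓ + ⌈β ^ (ℓ + 1)⌉₊
  /-- the coverage algorithm is run with the current estimate -/
  coverage_step : ∀ ℓ t, tCov ℓ ≤ t → t < tExp (ℓ + 1) →
    Environment.FMCStep tb (est (ℓ + 1)) (comm (t + 1)) (η t) (P t) (η (t + 1)) (P (t + 1))

end

end MultitaskCoverage

open MeasureTheory ProbabilityTheory MultitaskCoverage
open scoped Asymptotics

/-! The sampling points and sample counts depend only on the prior covariance, so the estimate used
in an epoch is a posterior mean after a deterministic number of samples, and its mean squared error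
is the posterior variance (`integral_sq_postMean_sub`).

Exploration is cheap (`trace_block_postCov_le_div`). Among `k` greedy samples, pigeonhole gives a
vertex sampled at least `k / |V|` times. Just before its last sample its posterior trace was already
`O(1/k)`, yet the greedy rule preferred it; since `1 + tr B ≤ det (1 + B) ≤ exp (tr B)`, every other
trace was `O(1/k)` too. Hence accuracy `α ^ ℓ * τ` needs only `O(α ^ (-ℓ))` samples.

Coverage converges in a bounded number of slots (`coverage_converges`). Every actual move strictly
lowers `H_inf` and there are finitely many configurations, so the team soon becomes stable; two
further rounds of communication turn the coverings into the equitable partitions. From then on the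
regret for the true demand is at most a constant times the `ℓ¹` error of the estimate
(`abs_regret_le_of_isStable`), whose expectation is `O(√(α ^ ℓ))`.

Thus, over the first `L` epochs, exploration contributes `O(α ^ (-L))`, transients `O(L)`, and the
converged slots `O(∑ β ^ ℓ * √(α ^ ℓ))`. For `α = β ^ (-2/3)` the first and last are both `O(β ^
(2L/3))`, and `L` epochs last at least `β ^ L` slots. This gives `T ^ (2/3)`; the logarithms are
slack. Conditioning costs a factor `1 / μ A`, where `A` is the event of nonnegative demand, and is
trivial when `A` is null. -/

namespace MultitaskCoverage

open Matrix

/-! ### Posterior covariance for a possibly singular prior -/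

section PosteriorCovariance

variable {ι : Type*} [Fintype ι] [DecidableEq ι] {S : Matrix ι ι ℝ} {d : ι → ℝ}

/-- With `R = √D`, the identity `det (1 + AB) = det (1 + BA)` replaces `S * D` by the symmetric `R *
S * R`, and `1 + R * S * R` is positive definite. -/
theorem isUnit_det_one_add_mul_diagonal (hS : S.PosSemidef) (hd : ∀ i, 0 ≤ d i) :
    IsUnit (1 + S * diagonal d).det := by
  have h : diagonal d = diagonal (fun i => √(d i)) * diagonal (fun i => √(d i)) := by
    rw [diagonal_mul_diagonal]
    congr 1
    funext i
    exact (Real.mul_self_sqrt (hd i)).symm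
  rw [h, ← mul_assoc, det_one_add_mul_comm, ← mul_assoc]
  have h2 : (diagonal (fun i => √(d i)) * S * diagonal (fun i => √(d i))).PosSemidef := by
    have := hS.mul_mul_conjTranspose_same (diagonal (fun i => √(d i)))
    rwa [diagonal_conjTranspose] at this
  exact ((PosDef.one.add_posSemidef h2).det_pos.ne').isUnit

theorem one_add_mul_diagonal_mul_inv_mul (hS : S.PosSemidef) (hd : ∀ i, 0 ≤ d i) :
    (1 + S * diagonal d) * ((1 + S * diagonal d)⁻¹ * S) = S :=
  mul_nonsing_inv_cancel_left _ _ (isUnit_det_one_add_mul_diagonal hS hd)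

theorem transpose_inv_one_add_mul_diagonal_mul (hS : S.PosSemidef) (hd : ∀ i, 0 ≤ d i) :
    ((1 + S * diagonal d)⁻¹ * S)ᵀ = (1 + S * diagonal d)⁻¹ * S := by
  have hu := isUnit_det_one_add_mul_diagonal hS hd
  have hSt : Sᵀ = S := by simpa using hS.isHermitian.eq
  have ht : (1 + S * diagonal d)ᵀ = 1 + diagonal d * S := by
    simp [transpose_mul, hSt]
  have hut : IsUnit (1 + diagonal d * S).det := by rw [← ht, det_transpose]; exact hu
  rw [transpose_mul, transpose_nonsing_inv, ht, hSt]
  have key : (1 + S * diagonal d) * S = S * (1 + diagonal d * S) := by noncomm_ring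
  calc S * (1 + diagonal d * S)⁻¹
      = (1 + S * diagonal d)⁻¹ * ((1 + S * diagonal d) * S) * (1 + diagonal d * S)⁻¹ := by
        rw [nonsing_inv_mul_cancel_left _ _ hu]
    _ = _ := by
        rw [key, ← mul_assoc, mul_nonsing_inv_cancel_right _ _ hut]

/-- The posterior variance of `x ⬝ᵥ Φ` is at most the variance of the error of any linear
estimator. -/
theorem dotProduct_posterior_le (hS : S.PosSemidef) (hd : ∀ i, 0 ≤ d i) (x w : ι → ℝ) :
    x ⬝ᵥ ((1 + S * diagonal d)⁻¹ * S) *ᵥ x ≤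
      (x - d * w) ⬝ᵥ S *ᵥ (x - d * w) + ∑ i, d i * w i ^ 2 ∧
    (w = ((1 + S * diagonal d)⁻¹ * S) *ᵥ x → x ⬝ᵥ ((1 + S * diagonal d)⁻¹ * S) *ᵥ x =
      (x - d * w) ⬝ᵥ S *ᵥ (x - d * w) + ∑ i, d i * w i ^ 2) := by
  set y := ((1 + S * diagonal d)⁻¹ * S) *ᵥ x with hy
  have hD : ∀ z : ι → ℝ, diagonal d *ᵥ z = d * z := fun z => by
    ext i; simp [mulVec_diagonal]
  have hSx : S *ᵥ x = y + S *ᵥ (d * y) := by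
    conv_lhs => rw [← one_add_mul_diagonal_mul_inv_mul hS hd]
    rw [← mulVec_mulVec, ← hy, add_mulVec, one_mulVec, ← mulVec_mulVec, hD]
  have hsym : ∀ a b : ι → ℝ, a ⬝ᵥ S *ᵥ b = b ⬝ᵥ S *ᵥ a := fun a b => by
    have hSt : Sᵀ = S := by simpa using hS.isHermitian.eq
    rw [dotProduct_mulVec, ← mulVec_transpose, hSt, dotProduct_comm]
  have hDs : ∀ a b : ι → ℝ, a ⬝ᵥ (d * b) = b ⬝ᵥ (d * a) := fun a b => by
    simp only [dotProduct, Pi.mul_apply]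
    exact Finset.sum_congr rfl fun i _ => by ring
  have hsum : ∑ i, d i * w i ^ 2 = w ⬝ᵥ (d * w) := by
    simp only [dotProduct, Pi.mul_apply]
    exact Finset.sum_congr rfl fun i _ => by ring
  -- Complete the square around the optimal weights `y`: the excess error is a nonnegative quadratic
  -- form in the deviation `z`.
  obtain ⟨z, hz⟩ : ∃ z, w = y + z := ⟨w - y, by abel⟩
  have hid : (x - d * w) ⬝ᵥ S *ᵥ (x - d * w) + ∑ i, d i * w i ^ 2 =
      x ⬝ᵥ y + ((d * z) ⬝ᵥ S *ᵥ (d * z) + z ⬝ᵥ (d * z)) := by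
    have h1 : S *ᵥ (x - d * w) = y - S *ᵥ (d * z) := by
      rw [mulVec_sub, hSx, hz, mul_add, mulVec_add]; abel
    have h2 : x ⬝ᵥ S *ᵥ (d * z) = y ⬝ᵥ (d * z) + (d * y) ⬝ᵥ S *ᵥ (d * z) := by
      rw [hsym, hSx, dotProduct_add, hsym (d * y), dotProduct_comm y]
    rw [hsum, h1, hz, mul_add]
    simp only [sub_dotProduct, add_dotProduct, dotProduct_sub, dotProduct_add]
    rw [h2, hDs z y, dotProduct_comm (d * y) y, dotProduct_comm (d * z) y]
    ring
  have hz0 : 0 ≤ z ⬝ᵥ (d * z) := by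
    refine Finset.sum_nonneg fun i _ => ?_
    simp only [Pi.mul_apply]
    nlinarith [mul_nonneg (hd i) (mul_self_nonneg (z i))]
  have hS0 : 0 ≤ (d * z) ⬝ᵥ S *ᵥ (d * z) := by
    simpa using hS.dotProduct_mulVec_nonneg (d * z)
  refine ⟨by rw [hid]; linarith, fun hw => ?_⟩
  have : z = 0 := by
    rw [hw] at hz
    simpa using hz
  rw [hid, this]
  simp

theorem posSemidef_inv_one_add_mul_diagonal_mul (hS : S.PosSemidef) (hd : ∀ i, 0 ≤ d i) :
    ((1 + S * diagonal d)⁻¹ * S).PosSemidef := by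
  refine PosSemidef.of_dotProduct_mulVec_nonneg ?_ fun x => ?_
  · rw [IsHermitian, conjTranspose_eq_transpose_of_trivial]
    exact transpose_inv_one_add_mul_diagonal_mul hS hd
  · rw [star_trivial, (dotProduct_posterior_le hS hd x _).2 rfl]
    have := hS.dotProduct_mulVec_nonneg (x - d * (((1 + S * diagonal d)⁻¹ * S) *ᵥ x))
    rw [star_trivial] at this
    exact add_nonneg this (Finset.sum_nonneg fun i _ => mul_nonneg (hd i) (sq_nonneg _))

/-- The optimal estimator for precision `d` can be imitated under the larger precision `d'`:
rescaling its weights by `d / d'` keeps the prior term and only shrinks the noise term. -/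
theorem posterior_diag_anti (hS : S.PosSemidef) {d' : ι → ℝ} (hd : ∀ i, 0 ≤ d i)
    (hdd : ∀ i, d i ≤ d' i) (i : ι) :
    ((1 + S * diagonal d')⁻¹ * S) i i ≤ ((1 + S * diagonal d)⁻¹ * S) i i := by
  have hd' : ∀ i, 0 ≤ d' i := fun i => (hd i).trans (hdd i)
  have hdiag : ∀ A : Matrix ι ι ℝ, A i i = Pi.single i 1 ⬝ᵥ A *ᵥ Pi.single i 1 := fun A => by simp
  rw [hdiag ((1 + S * diagonal d')⁻¹ * S), hdiag ((1 + S * diagonal d)⁻¹ * S)]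
  set x : ι → ℝ := Pi.single i 1
  set y := ((1 + S * diagonal d)⁻¹ * S) *ᵥ x with hy
  have h1 := (dotProduct_posterior_le hS hd' x (fun p => d p * y p / d' p)).1
  have h2 := (dotProduct_posterior_le hS hd x y).2 rfl
  have h3 : d' * (fun p => d p * y p / d' p) = d * y := by
    ext p
    simp only [Pi.mul_apply]
    -- Where `d' p = 0` also `d p = 0`, so the division by zero in the weight does no harm.
    rcases (hd' p).eq_or_lt with h | h
    · have : d p = 0 := le_antisymm (h ▸ hdd p) (hd p)
      simp [this]
    · field_simp
  rw [h3] at h1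
  rw [h2]
  refine h1.trans (add_le_add le_rfl (Finset.sum_le_sum fun p _ => ?_))
  rcases (hd' p).eq_or_lt with h | h
  · rw [← h]; simpa using mul_nonneg (hd p) (sq_nonneg _)
  · have : d' p * (d p * y p / d' p) ^ 2 = d p * y p ^ 2 * (d p / d' p) := by field_simp
    rw [this]
    exact mul_le_of_le_one_right (mul_nonneg (hd p) (sq_nonneg _))
      (div_le_one_of_le₀ (hdd p) (hd' p))

/-- The competitor ignores the prior and uses only the measurement of coordinate `i`; its error is
pure noise of variance `1 / d i`. -/
theorem posterior_diag_le_inv (hS : S.PosSemidef) (hd : ∀ i, 0 ≤ d i) (i : ι) (hi : 0 < d i) :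
    ((1 + S * diagonal d)⁻¹ * S) i i ≤ (d i)⁻¹ := by
  have hdiag : ∀ A : Matrix ι ι ℝ, A i i = Pi.single i 1 ⬝ᵥ A *ᵥ Pi.single i 1 := fun A => by simp
  rw [hdiag ((1 + S * diagonal d)⁻¹ * S)]
  refine (dotProduct_posterior_le hS hd _ (Pi.single i (d i)⁻¹)).1.trans ?_
  have h : d * Pi.single i (d i)⁻¹ = Pi.single i 1 := by
    ext p
    by_cases hp : p = i
    · subst hp; simp [hi.ne']
    · simp [hp]
  rw [h, sub_self, zero_dotProduct, zero_add, Finset.sum_eq_single i]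
  · rw [Pi.single_eq_same]
    apply le_of_eq
    field_simp
  · intro p _ hp; simp [hp]
  · simp

end PosteriorCovariance

theorem one_add_sum_le_prod_one_add {ι : Type*} (s : Finset ι) (f : ι → ℝ) (hf : ∀ i ∈ s, 0 ≤ f i) :
    1 + ∑ i ∈ s, f i ≤ ∏ i ∈ s, (1 + f i) := by
  classical
  induction s using Finset.induction_on with
  | empty => simp
  | insert a s ha ih =>
    rw [Finset.sum_insert ha, Finset.prod_insert ha]
    have h1 := ih fun i hi => hf i (Finset.mem_insert_of_mem hi)
    have h2 := hf a (Finset.mem_insert_self _ _)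
    have h3 : 0 ≤ ∑ i ∈ s, f i := Finset.sum_nonneg fun i hi => hf i (Finset.mem_insert_of_mem hi)
    nlinarith [mul_le_mul_of_nonneg_left h1 (by linarith : (0 : ℝ) ≤ 1 + f a)]

/-- Translates the greedy criterion, a determinant, into traces. Both bounds compare `∏ (1 + x i)`
with `∑ x i` for the eigenvalues `x i ≥ 0` of `B`, obtained as those of `1 + B` minus one. -/
theorem one_add_trace_le_det_and_det_le_exp_trace {m : Type*} [Fintype m] [DecidableEq m]
    {B : Matrix m m ℝ} (hB : B.PosSemidef) :
    1 + B.trace ≤ (1 + B).det ∧ (1 + B).det ≤ Real.exp B.trace := by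
  have hA : (1 + B).IsHermitian := isHermitian_one.add hB.isHermitian
  have htr : B.trace = ∑ i, (hA.eigenvalues i - 1) := by
    have := hA.trace_eq_sum_eigenvalues
    rw [trace_add, trace_one] at this
    rw [Finset.sum_sub_distrib]
    simp at this ⊢
    linarith
  have hdet : (1 + B).det = ∏ i, (1 + (hA.eigenvalues i - 1)) := by
    rw [hA.det_eq_prod_eigenvalues]
    simp
  have hge : ∀ i, 0 ≤ hA.eigenvalues i - 1 := fun i => by
    have h1 := hA.mulVec_eigenvectorBasis i
    set x : m → ℝ := (hA.eigenvectorBasis i).ofLp with hx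
    have h2 : B *ᵥ x = (hA.eigenvalues i - 1) • x := by
      rw [sub_smul, ← h1, add_mulVec, one_mulVec, one_smul]; abel
    have h3 := hB.dotProduct_mulVec_nonneg x
    rw [star_trivial, h2, dotProduct_smul, smul_eq_mul] at h3
    have h4 : x ⬝ᵥ x = 1 := by
      have := hA.eigenvectorBasis.orthonormal.1 i
      have h5 := EuclideanSpace.real_norm_sq_eq (hA.eigenvectorBasis i)
      rw [this] at h5
      simp only [dotProduct, ← sq]
      rw [hx, ← h5]; norm_num
    rwa [h4, mul_one] at h3
  rw [htr, hdet]
  refine ⟨one_add_sum_le_prod_one_add _ _ fun i _ => hge i, ?_⟩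
  rw [Real.exp_sum]
  refine Finset.prod_le_prod (fun i _ => by linarith [hge i]) fun i _ => ?_
  linarith [Real.add_one_le_exp (hA.eigenvalues i - 1)]

end MultitaskCoverage

namespace MultitaskCoverage

open Matrix

/-! ### Decay of posterior variances under greedy sampling -/

section GreedySampling

theorem trace_block {V : Type*} {M : ℕ} (C : Matrix (V × Fin M) (V × Fin M) ℝ) (v : V) :
    (block C v).trace = ∑ j, C (v, j) (v, j) := rfl

variable {V : Type*} [DecidableEq V] {M : ℕ}

/-- The diagonal of the precision contributed by the first `k` samples. -/
noncomputable def precisionDiag (M : ℕ) (σ : ℝ) (s : ℕ → V) (k : ℕ) : V × Fin M → ℝ :=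
  fun p => (sampleCount s k p.1 : ℝ) / σ ^ 2

theorem precisionDiag_nonneg (σ : ℝ) (s : ℕ → V) (k : ℕ) (p : V × Fin M) :
    0 ≤ precisionDiag M σ s k p := by
  unfold precisionDiag; positivity

theorem sampleCount_mono (s : ℕ → V) {m k : ℕ} (h : m ≤ k) (v : V) :
    sampleCount s m v ≤ sampleCount s k v :=
  Finset.card_le_card (Finset.filter_subset_filter _ (Finset.range_mono h))

theorem sampleCount_succ (s : ℕ → V) (k : ℕ) (v : V) :
    sampleCount s (k + 1) v = sampleCount s k v + if s k = v then 1 else 0 := by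
  unfold sampleCount
  rw [Finset.range_add_one, Finset.filter_insert]
  split_ifs with h
  · rw [Finset.card_insert_of_notMem (by simp)]
  · rfl

theorem exists_last_sample (s : ℕ → V) (v : V) (k : ℕ) (h : 1 ≤ sampleCount s k v) :
    ∃ m < k, s m = v ∧ sampleCount s m v + 1 = sampleCount s k v := by
  induction k with
  | zero => simp [sampleCount] at h
  | succ k ih =>
    rw [sampleCount_succ] at h ⊢
    split_ifs at h ⊢ with hk
    · exact ⟨k, by omega, hk, rfl⟩
    · obtain ⟨m, hm, h1, h2⟩ := ih (by omega)
      exact ⟨m, by omega, h1, by omega⟩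

theorem samplePrecision_eq_diagonal (σ : ℝ) (s : ℕ → V) (k : ℕ) :
    samplePrecision M σ s k = diagonal (precisionDiag M σ s k) := by
  rw [samplePrecision, ← diagonal_one, diagonal_kronecker_diagonal]
  simp [precisionDiag]

variable [Fintype V]

theorem exists_le_card_mul_sampleCount [Nonempty V] (s : ℕ → V) (k : ℕ) :
    ∃ v, k ≤ Fintype.card V * sampleCount s k v := by
  by_contra! h
  have h1 : ∑ v, sampleCount s k v = k := by
    unfold sampleCount
    rw [← Finset.card_eq_sum_card_fiberwise (f := s) (t := Finset.univ) (by simp)]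
    simp
  have h2 : ∑ v, Fintype.card V * sampleCount s k v < ∑ _v : V, k :=
    Finset.sum_lt_sum_of_nonempty Finset.univ_nonempty fun v _ => h v
  rw [← Finset.mul_sum, h1] at h2
  simp at h2

variable {S : Matrix (V × Fin M) (V × Fin M) ℝ} {σ : ℝ}

theorem posSemidef_postCov (hS : S.PosSemidef) (σ : ℝ) (s : ℕ → V) (k : ℕ) :
    (postCov S σ s k).PosSemidef := by
  rw [postCov, samplePrecision_eq_diagonal]
  exact posSemidef_inv_one_add_mul_diagonal_mul hS (precisionDiag_nonneg σ s k)

theorem postCov_zero (S : Matrix (V × Fin M) (V × Fin M) ℝ) (σ : ℝ) (s : ℕ → V) :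
    postCov S σ s 0 = S := by
  have : precisionDiag M σ s 0 = 0 := by ext p; simp [precisionDiag, sampleCount]
  rw [postCov, samplePrecision_eq_diagonal, this]
  simp

theorem trace_block_postCov_anti (hS : S.PosSemidef) (σ : ℝ) (s : ℕ → V) {m k : ℕ} (h : m ≤ k)
    (v : V) : (block (postCov S σ s k) v).trace ≤ (block (postCov S σ s m) v).trace := by
  rw [trace_block, trace_block]
  refine Finset.sum_le_sum fun j _ => ?_
  rw [postCov, postCov, samplePrecision_eq_diagonal, samplePrecision_eq_diagonal]
  refine posterior_diag_anti hS (precisionDiag_nonneg σ s m) (fun p => ?_) _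
  have := sampleCount_mono s h p.1
  unfold precisionDiag
  gcongr

theorem trace_block_postCov_le (hS : S.PosSemidef) (hσ : 0 < σ) (s : ℕ → V) (k : ℕ) (v : V)
    (hv : 0 < sampleCount s k v) :
    (block (postCov S σ s k) v).trace ≤ M * (σ ^ 2 / sampleCount s k v) := by
  rw [trace_block]
  have h : ∀ j ∈ Finset.univ, (postCov S σ s k) (v, j) (v, j) ≤ σ ^ 2 / sampleCount s k v := by
    intro j _
    rw [postCov, samplePrecision_eq_diagonal]
    refine (posterior_diag_le_inv hS (precisionDiag_nonneg σ s k) (v, j) ?_).trans ?_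
    · unfold precisionDiag; positivity
    · unfold precisionDiag; rw [inv_div]
  refine (Finset.sum_le_sum h).trans ?_
  simp

/-- Under greedy sampling the posterior variances decay like `1 / k`. -/
theorem trace_block_postCov_le_div [Nonempty V] (hS : S.PosSemidef) (hσ : 0 < σ) {s : ℕ → V}
    (hs : IsGreedy S σ s) (k : ℕ) (hk : 2 * Fintype.card V ≤ k) (v : V) :
    (block (postCov S σ s k) v).trace ≤
      σ ^ 2 * (M * Real.exp M) * (2 * Fintype.card V) / k := by
  have hc : 0 < Fintype.card V := Fintype.card_pos
  obtain ⟨v₀, hv₀⟩ := exists_le_card_mul_sampleCount s k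
  -- Two samples are needed so that one remains before the last one, making `n ≥ 1`; this is where
  -- `2 * Fintype.card V ≤ k` enters.
  have h2 : 2 ≤ sampleCount s k v₀ := by
    by_contra! h
    have : Fintype.card V * sampleCount s k v₀ ≤ Fintype.card V * 1 :=
      Nat.mul_le_mul_left _ (by omega)
    omega
  obtain ⟨m, hm, hsm, hcount⟩ := exists_last_sample s v₀ k (by omega)
  set n := sampleCount s m v₀ with hn
  have hn1 : 1 ≤ n := by omega
  have hnk : k ≤ 2 * Fintype.card V * n := by
    calc k ≤ Fintype.card V * sampleCount s k v₀ := hv₀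
      _ ≤ Fintype.card V * (2 * n) := Nat.mul_le_mul_left _ (by omega)
      _ = _ := by ring
  -- Variances only decrease, so it suffices to bound them at time `m`, when the greedy rule
  -- compared every `v` with `v₀`.
  refine (trace_block_postCov_anti hS σ s hm.le v).trans ?_
  have hB : ∀ v', ((σ ^ 2)⁻¹ • block (postCov S σ s m) v').PosSemidef := fun v' =>
    ((posSemidef_postCov hS σ s m).submatrix _).smul (by positivity)
  have hg := hs m v
  rw [hsm] at hg
  have h3 := (one_add_trace_le_det_and_det_le_exp_trace (hB v)).1
  have h4 := (one_add_trace_le_det_and_det_le_exp_trace (hB v₀)).2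
  rw [trace_smul, smul_eq_mul] at h3 h4
  have h5 := trace_block_postCov_le hS hσ s m v₀ (by omega)
  rw [← hn] at h5
  have hn' : (1 : ℝ) ≤ n := by exact_mod_cast hn1
  have hn0 : (0 : ℝ) < n := by linarith
  set x : ℝ := M / n with hx
  have hx0 : 0 ≤ x := by positivity
  have hxM : x ≤ M := div_le_self (by positivity) hn'
  have h6 : (σ ^ 2)⁻¹ * (block (postCov S σ s m) v₀).trace ≤ x := by
    calc _ ≤ (σ ^ 2)⁻¹ * (M * (σ ^ 2 / n)) := by gcongr
      _ = x := by rw [hx]; field_simp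
  -- Multiply `1 - x ≤ exp (-x)` by `exp x` to get `exp x - 1 ≤ x * exp x`, then use `x ≤ M`.
  have h7 : Real.exp x - 1 ≤ x * Real.exp M := by
    have e1 := Real.add_one_le_exp (-x)
    have e2 : Real.exp x * Real.exp (-x) = 1 := by rw [← Real.exp_add]; simp
    have e3 := Real.exp_pos x
    have e4 : x * Real.exp x ≤ x * Real.exp M := by gcongr
    nlinarith
  have h8 : (σ ^ 2)⁻¹ * (block (postCov S σ s m) v).trace ≤ x * Real.exp M := by
    have := Real.exp_le_exp.2 h6
    linarith
  have hσ2 : 0 < σ ^ 2 := by positivity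
  rw [inv_mul_le_iff₀ hσ2] at h8
  refine h8.trans ?_
  have hk0 : (0 : ℝ) < k := by
    have : 0 < k := by omega
    exact_mod_cast this
  have hnk' : (k : ℝ) ≤ 2 * Fintype.card V * n := by exact_mod_cast hnk
  have : (1 : ℝ) / n ≤ 2 * Fintype.card V / k := by
    rw [div_le_div_iff₀ hn0 hk0]; linarith
  calc σ ^ 2 * (x * Real.exp M) = σ ^ 2 * (M * Real.exp M) * (1 / n) := by rw [hx]; ring
    _ ≤ σ ^ 2 * (M * Real.exp M) * (2 * Fintype.card V / k) := by gcongr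
    _ = _ := by ring

/-- Everything the analysis needs to know about the number of samples. -/
theorem sampleTotal_bounds [Nonempty V] (hS : S.PosSemidef) (hσ : 0 < σ) {s : ℕ → V}
    (hs : IsGreedy S σ s) {α τ : ℝ} (hα0 : 0 < α) (hα1 : α < 1)
    (hτ : ∀ v, (block S v).trace ≤ τ) :
    Monotone (sampleTotal S σ s α τ) ∧
    (∀ ℓ v, (block (postCov S σ s (sampleTotal S σ s α τ ℓ)) v).trace ≤ α ^ ℓ * τ) ∧
    ∃ C : ℝ, 0 ≤ C ∧ ∀ ℓ, (sampleTotal S σ s α τ ℓ : ℝ) ≤ C * (α ^ ℓ)⁻¹ := by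
  have hτ0 : 0 ≤ τ := by
    obtain ⟨v⟩ := ‹Nonempty V›
    exact ((hS.submatrix _).trace_nonneg).trans (hτ v)
  set C₀ : ℝ := σ ^ 2 * (M * Real.exp M) * (2 * Fintype.card V) with hC₀
  have hC₀0 : 0 ≤ C₀ := by positivity
  -- An explicit sufficient number of samples; the second summand meets the threshold of the decay
  -- estimate. For `τ = 0` the quotient is `0` by convention, and the prior traces already meet the
  -- target.
  set K : ℕ → ℕ := fun ℓ => ⌈C₀ / (α ^ ℓ * τ)⌉₊ + 2 * Fintype.card V with hK
  have hKmem : ∀ ℓ k, K ℓ ≤ k → ∀ v, (block (postCov S σ s k) v).trace ≤ α ^ ℓ * τ := by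
    intro ℓ k hk v
    rcases hτ0.eq_or_lt with h0 | h0
    · have := trace_block_postCov_anti hS σ s (Nat.zero_le k) v
      rw [postCov_zero] at this
      rw [← h0, mul_zero, h0]
      exact this.trans (hτ v)
    · refine (trace_block_postCov_le_div hS hσ hs k (by simp only [hK] at hk; omega) v).trans ?_
      have hc : 0 < Fintype.card V := Fintype.card_pos
      have hk0 : (0 : ℝ) < k := by
        have : 0 < k := by simp only [hK] at hk; omega
        exact_mod_cast this
      rw [← hC₀, div_le_iff₀ hk0, ← div_le_iff₀' (by positivity)]
      refine (Nat.le_ceil _).trans ?_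
      exact_mod_cast (by simp only [hK] at hk; omega)
  have hKmono : Monotone K := by
    refine monotone_nat_of_le_succ fun ℓ => ?_
    simp only [hK]
    refine Nat.add_le_add_right (Nat.ceil_mono ?_) _
    rcases hτ0.eq_or_lt with h0 | h0
    · simp [← h0]
    · refine div_le_div_of_nonneg_left hC₀0 (by positivity) (mul_le_mul_of_nonneg_right ?_ hτ0)
      exact pow_le_pow_of_le_one hα0.le hα1.le (Nat.le_succ _)
  -- Nonemptiness is what makes the `sInf` in `sampleTotal` an attained minimum instead of a default
  -- `0`.
  have hne : ∀ ℓ, {k | sampleTotal S σ s α τ ℓ ≤ k ∧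
      ∀ v, (block (postCov S σ s k) v).trace ≤ α ^ (ℓ + 1) * τ}.Nonempty := fun ℓ =>
    ⟨max (sampleTotal S σ s α τ ℓ) (K (ℓ + 1)), le_max_left _ _, hKmem _ _ (le_max_right _ _)⟩
  have hle : ∀ ℓ, sampleTotal S σ s α τ ℓ ≤ K ℓ := by
    intro ℓ
    induction ℓ with
    | zero => simp [sampleTotal]
    | succ ℓ ih =>
      rw [sampleTotal]
      exact Nat.sInf_le ⟨ih.trans (hKmono (Nat.le_succ _)), hKmem _ _ le_rfl⟩
  refine ⟨monotone_nat_of_le_succ fun ℓ => ?_, fun ℓ => ?_,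
    C₀ / τ + 1 + 2 * Fintype.card V, by positivity, fun ℓ => ?_⟩
  · conv_rhs => rw [sampleTotal]
    exact (Nat.sInf_mem (hne ℓ)).1
  · cases ℓ with
    | zero => intro v; simpa [sampleTotal, postCov_zero] using hτ v
    | succ ℓ =>
      rw [sampleTotal]
      exact (Nat.sInf_mem (hne ℓ)).2
  · have h1 : (sampleTotal S σ s α τ ℓ : ℝ) ≤ K ℓ := by exact_mod_cast hle ℓ
    have h2 : (K ℓ : ℝ) ≤ C₀ / (α ^ ℓ * τ) + 1 + 2 * Fintype.card V := by
      simp only [hK]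
      push_cast
      gcongr
      exact (Nat.ceil_lt_add_one (by positivity)).le
    have h3 : 1 ≤ (α ^ ℓ)⁻¹ := (one_le_inv₀ (by positivity)).2 (pow_le_one₀ hα0.le hα1.le)
    have h4 : C₀ / (α ^ ℓ * τ) = C₀ / τ * (α ^ ℓ)⁻¹ := by
      rw [mul_comm, ← div_div, div_eq_mul_inv (C₀ / τ)]
    have h5 : (0 : ℝ) ≤ 1 + 2 * Fintype.card V := by positivity
    calc (sampleTotal S σ s α τ ℓ : ℝ)
        ≤ C₀ / τ * (α ^ ℓ)⁻¹ + (1 + 2 * Fintype.card V) * 1 := by linarith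
      _ ≤ C₀ / τ * (α ^ ℓ)⁻¹ + (1 + 2 * Fintype.card V) * (α ^ ℓ)⁻¹ := by gcongr
      _ = _ := by ring

end GreedySampling

/-! ### Positive semidefiniteness of the squared-exponential kernel -/

section SquaredExponential

/-- The squared-exponential kernel is positive semidefinite, being the characteristic function of a
Gaussian measure at differences of points. -/
theorem posSemidef_seKernel {V : Type*} [Fintype V] [DecidableEq V]
    (pos : V → EuclideanSpace ℝ (Fin 2)) (σv len : ℝ) (hlen : 0 < len) :
    (seKernel pos σv len).PosSemidef := by
  set γ := stdGaussian (EuclideanSpace ℝ (Fin 2))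
  have hker : ∀ v v', seKernel pos σv len v v' =
      σv ^ 2 * ∫ g, Real.cos (inner ℝ g (len⁻¹ • (pos v - pos v'))) ∂γ := by
    intro v v'
    have h1 := charFun_stdGaussian (len⁻¹ • (pos v - pos v'))
    rw [charFun_apply] at h1
    have h2 := congrArg Complex.re h1
    have hint : Integrable (fun g => Complex.exp
        ((inner ℝ g (len⁻¹ • (pos v - pos v')) : ℝ) * Complex.I)) γ := by
      refine Integrable.of_bound (by fun_prop) 1 (.of_forall fun g => ?_)
      rw [Complex.norm_exp_ofReal_mul_I]
    have h3 := integral_re hint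
    simp only [RCLike.re_eq_complex_re, Complex.exp_ofReal_mul_I_re] at h3
    rw [h3, h2, norm_smul, ← dist_eq_norm, ← Complex.ofReal_pow, ← Complex.ofReal_neg,
      show ((2 : ℂ)) = ((2 : ℝ) : ℂ) by simp, ← Complex.ofReal_div, Complex.exp_ofReal_re]
    simp only [seKernel, of_apply]
    congr 2
    rw [mul_pow, norm_inv, Real.norm_eq_abs, inv_pow, sq_abs]
    field_simp
  refine PosSemidef.of_dotProduct_mulVec_nonneg ?_ fun x => ?_
  · ext v v'
    simp [seKernel, dist_comm]
  · rw [star_trivial]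
    simp only [dotProduct, mulVec]
    have hexp : ∑ v, x v * ∑ v', seKernel pos σv len v v' * x v' = σv ^ 2 * ∫ g,
        ((∑ v, x v * Real.cos (inner ℝ g (len⁻¹ • pos v))) ^ 2 +
         (∑ v, x v * Real.sin (inner ℝ g (len⁻¹ • pos v))) ^ 2) ∂γ := by
      -- The addition formula for `cos (a - b)` splits the double sum into two squares, so the
      -- quadratic form is the integral of a nonnegative function.
      have hsq : ∀ g : EuclideanSpace ℝ (Fin 2),
          (∑ v, x v * Real.cos (inner ℝ g (len⁻¹ • pos v))) ^ 2 +
          (∑ v, x v * Real.sin (inner ℝ g (len⁻¹ • pos v))) ^ 2 =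
          ∑ v, ∑ v', x v * x v' * Real.cos (inner ℝ g (len⁻¹ • (pos v - pos v'))) := by
        intro g
        rw [sq, sq, Finset.sum_mul_sum, Finset.sum_mul_sum, ← Finset.sum_add_distrib]
        refine Finset.sum_congr rfl fun v _ => ?_
        rw [← Finset.sum_add_distrib]
        refine Finset.sum_congr rfl fun v' _ => ?_
        rw [smul_sub, inner_sub_right, Real.cos_sub]
        ring
      have hint : ∀ v v', Integrable (fun g => x v * x v' *
          Real.cos (inner ℝ g (len⁻¹ • (pos v - pos v')))) γ := fun v v' => by
        refine Integrable.const_mul ?_ _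
        refine Integrable.of_bound (by fun_prop) 1 (.of_forall fun g => ?_)
        exact Real.abs_cos_le_one _
      simp_rw [hsq]
      rw [integral_finsetSum _ fun v _ => integrable_finsetSum _ fun v' _ => hint v v',
        Finset.mul_sum]
      refine Finset.sum_congr rfl fun v _ => ?_
      rw [integral_finsetSum _ fun v' _ => hint v v', Finset.mul_sum, Finset.mul_sum]
      refine Finset.sum_congr rfl fun v' _ => ?_
      rw [integral_const_mul, hker]
      ring
    rw [hexp]
    exact mul_nonneg (sq_nonneg _) (integral_nonneg fun g => by positivity)

end SquaredExponential

end MultitaskCoverage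

namespace MultitaskCoverage

open Matrix

/-! ### Mean squared error of the posterior mean -/

section PosteriorError

theorem gaussian_linear_moments {ι Ω : Type*} [Fintype ι] [DecidableEq ι] [MeasurableSpace Ω]
    {P : Measure Ω} {m : EuclideanSpace ℝ ι} {S : Matrix ι ι ℝ} (hS : S.PosSemidef)
    {X : Ω → EuclideanSpace ℝ ι} (hX : HasLaw X (multivariateGaussian m S) P) (a : ι → ℝ) :
    MemLp (fun ω => a ⬝ᵥ (X ω).ofLp) 2 P ∧ ∫ ω, a ⬝ᵥ (X ω).ofLp ∂P = a ⬝ᵥ m.ofLp ∧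
      Var[fun ω => a ⬝ᵥ (X ω).ofLp; P] = a ⬝ᵥ S *ᵥ a := by
  have hL : ∀ x : EuclideanSpace ℝ ι, a ⬝ᵥ x.ofLp = innerSL ℝ (WithLp.toLp 2 a) x := fun x => by
    simp [PiLp.inner_apply, dotProduct, mul_comm]
  have hLp : MemLp (innerSL ℝ (WithLp.toLp 2 a)) 2 (multivariateGaussian m S) :=
    (innerSL ℝ (WithLp.toLp 2 a)).comp_memLp' IsGaussian.memLp_two_id
  simp_rw [hL]
  refine ⟨?_, ?_, ?_⟩
  · rw [← hX.map_eq] at hLp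
    exact (memLp_map_measure_iff (by fun_prop) hX.aemeasurable).1 hLp
  · have := hX.integral_comp (f := innerSL ℝ (WithLp.toLp 2 a)) (by fun_prop)
    simp only [Function.comp_def] at this
    rw [this, (innerSL ℝ (WithLp.toLp 2 a)).integral_comp_comm IsGaussian.integrable_fun_id,
      integral_id_multivariateGaussian]
  · have h1 := hX.covariance_fun_comp (f := innerSL ℝ (WithLp.toLp 2 a))
      (g := innerSL ℝ (WithLp.toLp 2 a)) (by fun_prop) (by fun_prop)
    have h2 := covarianceBilin_multivariateGaussian (μ := m) hS (WithLp.toLp 2 a) (WithLp.toLp 2 a)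
    rw [covarianceBilin_apply_eq_cov IsGaussian.memLp_two_id] at h2
    rw [← covariance_self, h1, ← hL]
    · exact h2
    · exact (innerSL ℝ (WithLp.toLp 2 a)).continuous.measurable.comp_aemeasurable hX.aemeasurable

variable {V : Type*} [DecidableEq V] {M : ℕ}

theorem sampleSum_add_noise (σ : ℝ) (s : ℕ → V) (φ : V × Fin M → ℝ) (e : ℕ → Fin M → ℝ) (k : ℕ) :
    sampleSum σ s (fun m j => φ (s m, j) + e m j) k =
      precisionDiag M σ s k * φ + sampleSum σ s e k := by
  ext p
  simp only [sampleSum, precisionDiag, sampleCount, Pi.add_apply, Pi.mul_apply,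
    Finset.sum_add_distrib, add_div]
  congr 1
  rw [Finset.sum_congr rfl (g := fun _ => φ p) fun m hm => by
    rw [(Finset.mem_filter.1 hm).2], Finset.sum_const, nsmul_eq_mul]
  ring

variable [Fintype V]

/-- Regroups by observation instead of by vertex, so that independence of the individual noises can
be used. -/
theorem dotProduct_sampleSum (σ : ℝ) (s : ℕ → V) (e : ℕ → Fin M → ℝ) (k : ℕ)
    (c : V × Fin M → ℝ) :
    c ⬝ᵥ sampleSum σ s e k =
      ∑ m ∈ Finset.range k, (fun j => c (s m, j) / σ ^ 2) ⬝ᵥ e m := by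
  simp only [dotProduct, sampleSum]
  rw [Finset.sum_comm, Fintype.sum_prod_type, Finset.sum_comm]
  refine Finset.sum_congr rfl fun j _ => ?_
  simp_rw [Finset.sum_filter, Finset.sum_div, Finset.mul_sum]
  rw [Finset.sum_comm]
  refine Finset.sum_congr rfl fun m _ => ?_
  rw [Finset.sum_eq_single (s m)]
  · simp; ring
  · intro v _ hv; simp [hv.symm]
  · simp

theorem sum_sampleCount_mul (s : ℕ → V) (k : ℕ) (g : V → ℝ) :
    ∑ v, sampleCount s k v * g v = ∑ m ∈ Finset.range k, g (s m) := by
  rw [← Finset.sum_fiberwise (Finset.range k) s]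
  refine Finset.sum_congr rfl fun v _ => ?_
  rw [Finset.sum_congr rfl (g := fun _ => g v) fun m hm => by rw [(Finset.mem_filter.1 hm).2],
    Finset.sum_const, nsmul_eq_mul, sampleCount]

variable {S : Matrix (V × Fin M) (V × Fin M) ℝ} {σ : ℝ}

/-- Writing `φ = (1 + S D)⁻¹ (φ + S D φ)` cancels the signal part of the samples; only noise and the
deviation from the prior mean remain. -/
theorem postMean_sub (hS : S.PosSemidef) (μ₀ φ : V × Fin M → ℝ) (s : ℕ → V)
    (e : ℕ → Fin M → ℝ) (k : ℕ) :
    postMean μ₀ S σ s (fun m j => φ (s m, j) + e m j) k - φ =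
      (1 + S * diagonal (precisionDiag M σ s k))⁻¹ *ᵥ
        (S *ᵥ sampleSum σ s e k - (φ - μ₀)) := by
  have hu := isUnit_det_one_add_mul_diagonal hS (precisionDiag_nonneg (M := M) σ s k)
  rw [postMean, samplePrecision_eq_diagonal, sampleSum_add_noise]
  set d := precisionDiag M σ s k
  have hφ : φ = (1 + S * diagonal d)⁻¹ *ᵥ (φ + S *ᵥ (d * φ)) := by
    have hD : d * φ = diagonal d *ᵥ φ := by ext i; simp [mulVec_diagonal]
    have : φ + S *ᵥ (d * φ) = (1 + S * diagonal d) *ᵥ φ := by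
      rw [hD, add_mulVec, one_mulVec, mulVec_mulVec]
    rw [this, mulVec_mulVec, nonsing_inv_mul _ hu, one_mulVec]
  nth_rw 2 [hφ]
  rw [← mulVec_sub]
  congr 1
  rw [mulVec_add]
  abel

/-- The mean squared error of the posterior mean is the posterior variance. -/
theorem integral_sq_postMean_sub (hS : S.PosSemidef) (hσ : 0 < σ)
    {Ω : Type*} [MeasurableSpace Ω] {P : Measure Ω} [IsProbabilityMeasure P]
    {μ₀ : EuclideanSpace ℝ (V × Fin M)} {Φ : Ω → EuclideanSpace ℝ (V × Fin M)}
    (hΦ : HasLaw Φ (multivariateGaussian μ₀ S) P)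
    {ε : ℕ → Ω → EuclideanSpace ℝ (Fin M)}
    (hε : ∀ k, HasLaw (ε k) (multivariateGaussian 0 (σ ^ 2 • (1 : Matrix (Fin M) (Fin M) ℝ))) P)
    (hε_indep : iIndepFun ε P) (hΦε_indep : IndepFun Φ (fun ω k => ε k ω) P)
    (s : ℕ → V) (k : ℕ) (p : V × Fin M) :
    MemLp (fun ω => postMean (fun p => μ₀ p) S σ s (fun m j => Φ ω (s m, j) + ε m ω j) k p
      - Φ ω p) 2 P ∧
    ∫ ω, (postMean (fun p => μ₀ p) S σ s (fun m j => Φ ω (s m, j) + ε m ω j) k p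
      - Φ ω p) ^ 2 ∂P = postCov S σ s k p p := by
  have hd := precisionDiag_nonneg (M := M) σ s k
  have hu := isUnit_det_one_add_mul_diagonal hS hd
  set d := precisionDiag M σ s k with hdd
  set A := (1 + S * diagonal d)⁻¹ with hA
  set a : V × Fin M → ℝ := A p with ha
  have hSt : Sᵀ = S := by simpa using hS.isHermitian.eq
  set c := S *ᵥ a with hc
  set Z : ℕ → Ω → ℝ := fun m ω => (fun j => c (s m, j) / σ ^ 2) ⬝ᵥ (ε m ω).ofLp with hZ
  set W : Ω → ℝ := fun ω => a ⬝ᵥ (Φ ω).ofLp with hW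
  have herr : (fun ω => postMean (fun p => μ₀ p) S σ s (fun m j => Φ ω (s m, j) + ε m ω j) k p
      - Φ ω p) = fun ω => (∑ m ∈ Finset.range k, Z m ω) - (W ω - a ⬝ᵥ μ₀.ofLp) := by
    funext ω
    have h := congrFun (postMean_sub (σ := σ) hS (fun p => μ₀ p) (fun p => Φ ω p) s
      (fun m j => ε m ω j) k) p
    rw [Pi.sub_apply] at h
    rw [h]
    change a ⬝ᵥ _ = _
    rw [dotProduct_sub, dotProduct_mulVec, ← mulVec_transpose, hSt, ← hc,
      dotProduct_sampleSum, dotProduct_sub]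
  have hcov : (σ ^ 2 • (1 : Matrix (Fin M) (Fin M) ℝ)).PosSemidef :=
    PosSemidef.one.smul (by positivity)
  have hZm := fun m => gaussian_linear_moments hcov (hε m) (fun j => c (s m, j) / σ ^ 2)
  obtain ⟨hW1, hW2, hW3⟩ := gaussian_linear_moments hS hΦ a
  have hZsum : MemLp (fun ω => ∑ m ∈ Finset.range k, Z m ω) 2 P :=
    memLp_finsetSum _ fun m _ => (hZm m).1
  have hWc : MemLp (fun ω => W ω - a ⬝ᵥ μ₀.ofLp) 2 P := hW1.sub (memLp_const _)
  have hindZ : Set.Pairwise (Finset.range k : Set ℕ) fun m m' => IndepFun (Z m) (Z m') P := by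
    intro m _ m' _ hmm
    exact (hε_indep.indepFun hmm).comp
      (φ := fun x : EuclideanSpace ℝ (Fin M) => (fun j => c (s m, j) / σ ^ 2) ⬝ᵥ x.ofLp)
      (ψ := fun x : EuclideanSpace ℝ (Fin M) => (fun j => c (s m', j) / σ ^ 2) ⬝ᵥ x.ofLp)
      (by simp only [dotProduct]; fun_prop) (by simp only [dotProduct]; fun_prop)
  have hind : IndepFun (fun ω => ∑ m ∈ Finset.range k, Z m ω) (fun ω => W ω - a ⬝ᵥ μ₀.ofLp) P :=
    hΦε_indep.symm.comp
      (φ := fun x : ℕ → EuclideanSpace ℝ (Fin M) =>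
        ∑ m ∈ Finset.range k, (fun j => c (s m, j) / σ ^ 2) ⬝ᵥ (x m).ofLp)
      (ψ := fun x : EuclideanSpace ℝ (V × Fin M) => a ⬝ᵥ x.ofLp - a ⬝ᵥ μ₀.ofLp)
      (by simp only [dotProduct]; fun_prop) (by simp only [dotProduct]; fun_prop)
  rw [herr]
  have hmem : MemLp (fun ω => (∑ m ∈ Finset.range k, Z m ω) - (W ω - a ⬝ᵥ μ₀.ofLp)) 2 P :=
    hZsum.sub hWc
  refine ⟨hmem, ?_⟩
  have hmean : ∫ ω, ((∑ m ∈ Finset.range k, Z m ω) - (W ω - a ⬝ᵥ μ₀.ofLp)) ∂P = 0 := by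
    rw [integral_sub (hZsum.integrable (by norm_num)) (hWc.integrable (by norm_num)),
      integral_finsetSum _ fun m _ => (hZm m).1.integrable (by norm_num),
      integral_sub (hW1.integrable (by norm_num)) (integrable_const _), hW2,
      Finset.sum_eq_zero fun m _ => by rw [(hZm m).2.1]; simp]
    simp
  have herr' : ∀ ω, postMean (fun p => μ₀ p) S σ s (fun m j => Φ ω (s m, j) + ε m ω j) k p
      - Φ ω p = (∑ m ∈ Finset.range k, Z m ω) - (W ω - a ⬝ᵥ μ₀.ofLp) := congrFun herr
  simp_rw [herr']
  -- The error is centred and a difference of independent parts, the first a sum of pairwise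
  -- independent noises, so the variances add.
  have hvar : Var[fun ω => (∑ m ∈ Finset.range k, Z m ω) - (W ω - a ⬝ᵥ μ₀.ofLp); P] =
      (∑ m ∈ Finset.range k, Var[Z m; P]) + a ⬝ᵥ S *ᵥ a := by
    rw [variance_fun_sub hZsum hWc, hind.covariance_eq_zero hZsum hWc,
      variance_sub_const hW1.aestronglyMeasurable, hW3]
    have := IndepFun.variance_sum (fun m (_ : m ∈ Finset.range k) => (hZm m).1) hindZ
    rw [Finset.sum_fn] at this
    rw [this]
    ring
  rw [variance_of_integral_eq_zero hmem.aemeasurable hmean] at hvar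
  rw [hvar]
  have hsum : ∑ m ∈ Finset.range k, Var[Z m; P] = c ⬝ᵥ (d * c) := by
    have h1 : ∀ m, Var[Z m; P] = (fun v => (∑ j, c (v, j) ^ 2) / σ ^ 2) (s m) := fun m => by
      rw [(hZm m).2.2]
      simp only [smul_mulVec, one_mulVec, dotProduct, Pi.smul_apply, smul_eq_mul]
      rw [Finset.sum_div]
      refine Finset.sum_congr rfl fun j _ => ?_
      field_simp
    rw [Finset.sum_congr rfl fun m _ => h1 m, 
      ← sum_sampleCount_mul s k fun v => (∑ j, c (v, j) ^ 2) / σ ^ 2, dotProduct, Fintype.sum_prod_type]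
    refine Finset.sum_congr rfl fun v _ => ?_
    simp only [hdd, precisionDiag, Pi.mul_apply]
    rw [Finset.sum_div, Finset.mul_sum]
    refine Finset.sum_congr rfl fun j _ => ?_
    ring
  rw [hsum, postCov, samplePrecision_eq_diagonal, ← hdd, ← hA]
  -- `a` is the `p`-th row of the inverse
  have hrow : a + d * c = Pi.single p 1 := by
    have h1 : A * (1 + S * diagonal d) = 1 := nonsing_inv_mul _ hu
    ext q
    have h2 := congrFun (congrFun h1 p) q
    rw [mul_add, mul_one, ← mul_assoc, Matrix.add_apply, mul_diagonal] at h2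
    have h3 : (A * S) p q = c q := by
      rw [hc, mulVec, dotProduct_comm, mul_apply]
      simp only [dotProduct, ha]
      refine Finset.sum_congr rfl fun r _ => ?_
      rw [← congrFun (congrFun hSt q) r, transpose_apply]
    rw [h3] at h2
    simp only [Pi.add_apply, Pi.mul_apply, ha]
    rw [mul_comm, h2, one_apply, Pi.single_apply]
    simp only [eq_comm]
  -- Since `c = S a`, noise and prior variances combine into one product with `a + d * c`, a unit
  -- vector; it picks out `c p`, the diagonal entry of the posterior covariance.
  have h4 : c ⬝ᵥ (d * c) + a ⬝ᵥ S *ᵥ a = (a + d * c) ⬝ᵥ c := by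
    rw [← hc, add_dotProduct, dotProduct_comm c, add_comm]
  rw [h4, hrow, single_one_dotProduct, hc, mulVec, dotProduct_comm, mul_apply]
  simp only [dotProduct, ha]
  refine Finset.sum_congr rfl fun r _ => ?_
  conv_lhs => rw [← hSt, transpose_apply]

end PosteriorError

end MultitaskCoverage

namespace MultitaskCoverage

namespace Environment

theorem cost_eq_sum_robotCost {V : Type*} {N M : ℕ} {env : Environment V N M}
    (Φ : Demand V M) (η : Config V N) (P : Coverings V N M) :
    env.cost Φ η P = ∑ i, env.robotCost Φ P i (η i) := by
  rw [cost, Finset.sum_comm]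
  rfl

theorem iInf_service_eq {V : Type*} {N M : ℕ} {env : Environment V N M}
    (tb : env.TieBreak) (η : Config V N) (j : Fin M) (v : V) :
    ⨅ i, env.service i j (η i) v =
      env.service (tb.best η j v) j (η (tb.best η j v)) v := by
  have : Nonempty (Fin N) := ⟨tb.best η j v⟩
  exact le_antisymm (ciInf_le (Set.finite_range _).bddBelow _) (le_ciInf (tb.best_le η j v))

variable {V : Type*} [Fintype V] {N M : ℕ} {env : Environment V N M}

/-! ### Finite-time convergence of the coverage algorithm -/

section Coverage

variable [DecidableEq V]

/-- No single robot can decrease `H_inf` by moving. -/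
def IsStable (env : Environment V N M) (Φ : Demand V M) (η : Config V N) : Prop :=
  ∀ i x, env.costInf Φ η ≤ env.costInf Φ (Function.update η i x)

variable {tb : env.TieBreak} {Φ : Demand V M}

theorem FMCStep.eq_or_costInf_lt {c : Option (Fin N)} {η η' : Config V N} {P P' : Coverings V N M}
    (h : FMCStep tb Φ c η P η' P') : η' = η ∨ env.costInf Φ η' < env.costInf Φ η := by
  cases c with
  | none => exact Or.inl (h.1 rfl).1
  | some i =>
    obtain ⟨⟨x, rfl, -, h2⟩, -⟩ := h.2 i rfl
    by_cases hle : env.costInf Φ η ≤ env.costInf Φ (Function.update η i x)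
    · left; rw [h2 hle, Function.update_eq_self]
    · right; exact not_le.1 hle

theorem FMCStep.eq_of_isStable {c : Option (Fin N)} {η η' : Config V N} {P P' : Coverings V N M}
    (h : FMCStep tb Φ c η P η' P') (hη : env.IsStable Φ η) : η' = η := by
  cases c with
  | none => exact (h.1 rfl).1
  | some i =>
    obtain ⟨⟨x, rfl, -, h2⟩, -⟩ := h.2 i rfl
    rw [h2 (hη i x), Function.update_eq_self]

variable {comm : ℕ → Option (Fin N)} {η : ℕ → Config V N} {P : ℕ → Coverings V N M}
  {t₀ t₁ u : ℕ}

/-- `H_inf` is a strict Lyapunov function: a configuration once left is never revisited. -/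
theorem eq_or_costInf_lt_of_le
    (hstep : ∀ t, t₀ ≤ t → t < t₁ →
      FMCStep tb Φ (comm (t + 1)) (η t) (P t) (η (t + 1)) (P (t + 1)))
    {t r : ℕ} (ht : t₀ ≤ t) (htr : t ≤ r) (hr : r ≤ t₁) :
    η r = η t ∨ env.costInf Φ (η r) < env.costInf Φ (η t) := by
  induction r, htr using Nat.le_induction with
  | base => exact Or.inl rfl
  | succ r htr ih =>
    rcases (hstep r (ht.trans htr) hr).eq_or_costInf_lt with h | h
    · rw [h]; exact ih (by omega)
    · rcases ih (by omega) with h' | h'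
      · right; rwa [← h']
      · right; exact h.trans h'

theorem eq_of_isStable_of_le
    (hstep : ∀ t, t₀ ≤ t → t < t₁ →
      FMCStep tb Φ (comm (t + 1)) (η t) (P t) (η (t + 1)) (P (t + 1)))
    {t r : ℕ} (ht : t₀ ≤ t) (htr : t ≤ r) (hr : r ≤ t₁) (hst : env.IsStable Φ (η t)) :
    η r = η t := by
  induction r, htr using Nat.le_induction with
  | base => rfl
  | succ r htr ih =>
    have h := ih (by omega)
    rw [← h] at hst ⊢
    exact (hstep r (ht.trans htr) hr).eq_of_isStable hst

/-- Within `u` slots every robot communicates; if none moves, each was already at a minimizer of its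
own position. -/
theorem isStable_of_const
    (hstep : ∀ t, t₀ ≤ t → t < t₁ →
      FMCStep tb Φ (comm (t + 1)) (η t) (P t) (η (t + 1)) (P (t + 1)))
    (hcomm : ∀ i t, ∃ t', t < t' ∧ t' ≤ t + u ∧ comm t' = some i)
    {t : ℕ} (ht : t₀ ≤ t) (htu : t + u ≤ t₁) (hconst : ∀ r, t ≤ r → r ≤ t + u → η r = η t) :
    env.IsStable Φ (η t) := by
  intro i x
  obtain ⟨t', h1, h2, h3⟩ := hcomm i t
  obtain ⟨r, rfl⟩ : ∃ r, t' = r + 1 := ⟨t' - 1, by omega⟩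
  obtain ⟨⟨y, hy, hmin, -⟩, -⟩ := (hstep r (by omega) (by omega)).2 i h3
  rw [hconst (r + 1) (by omega) h2, hconst r (by omega) (by omega)] at hy
  rw [hconst r (by omega) (by omega), ← hy] at hmin
  exact hmin x

/-- The configuration is stable after at most one round of communications for each configuration
(plus one). -/
theorem isStable_of_card_le
    (hstep : ∀ t, t₀ ≤ t → t < t₁ →
      FMCStep tb Φ (comm (t + 1)) (η t) (P t) (η (t + 1)) (P (t + 1)))
    (hcomm : ∀ i t, ∃ t', t < t' ∧ t' ≤ t + u ∧ comm t' = some i) (n : ℕ) {t : ℕ} (ht : t₀ ≤ t)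
    (hn : (Finset.univ.filter fun e => env.costInf Φ e < env.costInf Φ (η t)).card ≤ n)
    (ht₁ : t + (n + 1) * u ≤ t₁) : env.IsStable Φ (η (t + (n + 1) * u)) := by
  induction n generalizing t with
  | zero =>
    rw [zero_add, one_mul] at ht₁ ⊢
    have hconst : ∀ r, t ≤ r → r ≤ t + u → η r = η t := by
      intro r h1 h2
      refine (eq_or_costInf_lt_of_le hstep ht h1 (h2.trans ht₁)).resolve_right fun h => ?_
      have := Finset.card_eq_zero.1 (Nat.le_zero.1 hn)
      exact Finset.notMem_empty (η r) (this ▸ by simpa using h)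
    rw [hconst (t + u) (by omega) le_rfl]
    exact isStable_of_const hstep hcomm ht ht₁ hconst
  | succ n ih =>
    have hexp : t + (n + 1 + 1) * u = t + u + (n + 1) * u := by ring
    have htu : t + u ≤ t₁ := le_trans (by rw [hexp]; omega) ht₁
    -- Either a round lowers `H_inf`, and then `η (t + u)` drops out of the set of cheaper
    -- configurations, or the configuration was constant throughout the round.
    by_cases hlt : env.costInf Φ (η (t + u)) < env.costInf Φ (η t)
    · rw [hexp] at ht₁ ⊢
      refine ih (by omega) (Nat.lt_succ_iff.1 (lt_of_lt_of_le (Finset.card_lt_card ?_) hn)) ht₁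
      refine Finset.ssubset_iff_of_subset (fun e he => ?_) |>.2 ⟨η (t + u), by simpa using hlt,
        by simp⟩
      simp only [Finset.mem_filter, Finset.mem_univ, true_and] at he ⊢
      exact he.trans hlt
    · have hconst : ∀ r, t ≤ r → r ≤ t + u → η r = η t := by
        intro r h1 h2
        refine (eq_or_costInf_lt_of_le hstep ht h1 (h2.trans htu)).resolve_right fun h => hlt ?_
        rcases eq_or_costInf_lt_of_le hstep (ht.trans h1) h2 htu with h' | h'
        · rwa [h']
        · exact h'.trans h
      have hst := isStable_of_const hstep hcomm ht htu hconst
      rwa [eq_of_isStable_of_le hstep ht (by omega) ht₁ hst]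

theorem FMCStep.mem_best {c : Option (Fin N)} {η η' : Config V N} {P P' : Coverings V N M}
    (h : FMCStep tb Φ c η P η' P') {j : Fin M} {v : V}
    (hv : v ∈ P j (tb.best η' j v) ∨ c = some (tb.best η' j v)) : v ∈ P' j (tb.best η' j v) := by
  cases c with
  | none =>
    rw [(h.1 rfl).2]
    simpa using hv
  | some i =>
    obtain ⟨-, hP⟩ := h.2 i rfl
    rw [hP j]
    by_cases hi : tb.best η' j v = i
    · subst hi
      rw [Function.update_self]
      exact Finset.mem_union_right _ (by simp [gain])
    · rw [Function.update_of_ne hi]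
      exact hv.resolve_right fun h => hi (Option.some.inj h).symm

/-- A communicating robot drops a vertex it does not serve best only if another robot owns it;
ownership by the best robot guarantees this. -/
theorem FMCStep.best_eq_of_mem {c : Option (Fin N)} {η η' : Config V N} {P P' : Coverings V N M}
    (h : FMCStep tb Φ c η P η' P') {j : Fin M} {v : V} {i : Fin N}
    (hbest : v ∈ P j (tb.best η' j v))
    (hi : (v ∈ P j i → tb.best η' j v = i) ∨ c = some i) (hv : v ∈ P' j i) :
    tb.best η' j v = i := by
  cases c with
  | none =>
    rw [(h.1 rfl).2] at hv
    exact (hi.resolve_right (by simp)) hv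
  | some k =>
    obtain ⟨-, hP⟩ := h.2 k rfl
    rw [hP j] at hv
    by_cases hk : i = k
    · subst hk
      rw [Function.update_self, Finset.mem_union, Finset.mem_sdiff] at hv
      by_contra hne
      rcases hv with ⟨h1, h2⟩ | h1
      · exact h2 (by simp only [loss, Finset.mem_filter]; exact ⟨h1, ⟨_, hne, hbest⟩, hne⟩)
      · simp only [gain, Finset.mem_filter] at h1
        exact hne h1.2
    · rw [Function.update_of_ne hk] at hv
      exact (hi.resolve_right fun h => hk (Option.some.inj h).symm) hv

/-- Once the configuration is stable, two rounds of communications turn the coverings into the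
equitable partitions. -/
theorem eq_equitable_of_isStable
    (hstep : ∀ t, t₀ ≤ t → t < t₁ →
      FMCStep tb Φ (comm (t + 1)) (η t) (P t) (η (t + 1)) (P (t + 1)))
    (hcomm : ∀ i t, ∃ t', t < t' ∧ t' ≤ t + u ∧ comm t' = some i)
    {t r : ℕ} (ht : t₀ ≤ t) (hst : env.IsStable Φ (η t)) (hr : t + 2 * u ≤ r) (hr₁ : r ≤ t₁) :
    P r = equitable tb (η r) := by
  have hη : ∀ r, t ≤ r → r ≤ t₁ → η r = η t := fun r h1 h2 =>
    eq_of_isStable_of_le hstep ht h1 h2 hst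
  set e := η t with he
  -- First round: each best robot claims its vertices and then never gives them up.
  have hbest : ∀ j v r, t + u ≤ r → r ≤ t₁ → v ∈ P r j (tb.best e j v) := by
    intro j v
    obtain ⟨t', h1, h2, h3⟩ := hcomm (tb.best e j v) t
    have key : ∀ r, t' ≤ r → r ≤ t₁ → v ∈ P r j (tb.best e j v) := by
      intro r hr hr₁
      obtain ⟨q, rfl⟩ : ∃ q, t' = q + 1 := ⟨t' - 1, by omega⟩
      induction r, hr using Nat.le_induction with
      | base =>
        have hq := hstep q (by omega) (by omega)
        have := hq.mem_best (j := j) (v := v)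
        rw [hη (q + 1) (by omega) hr₁] at this
        exact this (Or.inr h3)
      | succ r hr ih =>
        have hq := (hstep r (by omega) (by omega)).mem_best (j := j) (v := v)
        rw [hη (r + 1) (by omega) hr₁] at hq
        exact hq (Or.inl (ih (by omega)))
    exact fun r h => key r (by omega)
  -- Second round: all other owners release theirs, which is now allowed because the best robot is
  -- an owner.
  have honly : ∀ j v i r, t + 2 * u ≤ r → r ≤ t₁ → v ∈ P r j i → tb.best e j v = i := by
    intro j v i
    obtain ⟨t', h1, h2, h3⟩ := hcomm i (t + u)
    have key : ∀ r, t' ≤ r → r ≤ t₁ → v ∈ P r j i → tb.best e j v = i := by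
      intro r hr hr₁
      obtain ⟨q, rfl⟩ : ∃ q, t' = q + 1 := ⟨t' - 1, by omega⟩
      induction r, hr using Nat.le_induction with
      | base =>
        have hq := (hstep q (by omega) (by omega)).best_eq_of_mem (j := j) (v := v) (i := i)
        rw [hη (q + 1) (by omega) hr₁] at hq
        exact hq (hbest j v q (by omega) (by omega)) (Or.inr h3)
      | succ r hr ih =>
        have hq := (hstep r (by omega) (by omega)).best_eq_of_mem (j := j) (v := v) (i := i)
        rw [hη (r + 1) (by omega) hr₁] at hq
        exact hq (hbest j v r (by omega) (by omega)) (Or.inl (ih (by omega)))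
    exact fun r h => key r (by omega)
  rw [hη r (by omega) hr₁]
  funext j i
  ext v
  simp only [equitable, Finset.mem_filter, Finset.mem_univ, true_and]
  refine ⟨honly j v i r hr hr₁, fun h => ?_⟩
  rw [← h]
  exact hbest j v r (by omega) hr₁

/-- The coverage algorithm converges within a number of slots that depends neither on the demand
nor on the initial state. -/
theorem coverage_converges
    (hstep : ∀ t, t₀ ≤ t → t < t₁ →
      FMCStep tb Φ (comm (t + 1)) (η t) (P t) (η (t + 1)) (P (t + 1)))
    (hcomm : ∀ i t, ∃ t', t < t' ∧ t' ≤ t + u ∧ comm t' = some i)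
    {t : ℕ} (ht : t₀ + (Fintype.card (Config V N) + 3) * u ≤ t) (ht₁ : t ≤ t₁) :
    env.IsStable Φ (η t) ∧ P t = equitable tb (η t) := by
  -- At most one round per configuration plus one idle round for stability, then two rounds for the
  -- coverings.
  have hexp : t₀ + (Fintype.card (Config V N) + 3) * u =
    t₀ + (Fintype.card (Config V N) + 1) * u + 2 * u := by ring
  have hst := isStable_of_card_le hstep hcomm (Fintype.card (Config V N)) le_rfl
    (Finset.card_le_univ _) (by omega)
  refine ⟨?_, eq_equitable_of_isStable hstep hcomm (by omega) hst (by omega) ht₁⟩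
  rwa [eq_of_isStable_of_le hstep (by omega) (by omega) ht₁ hst]

end Coverage

/-! ### Regret bounds at a fixed time -/

section Regret

/-- The `ℓ¹` norm of a demand. -/
def demandNorm (Φ : Demand V M) : ℝ := ∑ j, ∑ v, |Φ v j|

theorem demandNorm_nonneg (Φ : Demand V M) : 0 ≤ demandNorm Φ :=
  Finset.sum_nonneg fun _ _ => Finset.sum_nonneg fun _ _ => abs_nonneg _

variable (env) in
theorem exists_service_bound : ∃ B, 0 ≤ B ∧ ∀ i j x v, |env.service i j x v| ≤ B := by
  refine ⟨∑ i, ∑ j, ∑ x, ∑ v, |env.service i j x v|, by positivity, fun i j x v => ?_⟩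
  calc |env.service i j x v|
      ≤ ∑ v, |env.service i j x v| := Finset.single_le_sum
        (f := fun v => |env.service i j x v|) (fun _ _ => abs_nonneg _) (Finset.mem_univ v)
    _ ≤ ∑ x, ∑ v, |env.service i j x v| := Finset.single_le_sum
        (f := fun x => ∑ v, |env.service i j x v|) (fun _ _ => by positivity) (Finset.mem_univ x)
    _ ≤ ∑ j, ∑ x, ∑ v, |env.service i j x v| := Finset.single_le_sum
        (f := fun j => ∑ x, ∑ v, |env.service i j x v|) (fun _ _ => by positivity)
        (Finset.mem_univ j)
    _ ≤ _ := Finset.single_le_sum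
        (f := fun i => ∑ j, ∑ x, ∑ v, |env.service i j x v|) (fun _ _ => by positivity)
        (Finset.mem_univ i)

theorem cost_equitable (tb : env.TieBreak) (Φ : Demand V M) (η η' : Config V N) :
    env.cost Φ η' (equitable tb η) =
      ∑ j, ∑ v, env.service (tb.best η j v) j (η' (tb.best η j v)) v * Φ v j := by
  refine Finset.sum_congr rfl fun j _ => ?_
  rw [← Finset.sum_fiberwise Finset.univ (tb.best η j)]
  refine Finset.sum_congr rfl fun i _ => ?_
  refine Finset.sum_congr (by ext; simp [equitable]) fun v hv => ?_
  rw [(Finset.mem_filter.1 hv).2]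

theorem cost_equitable_self (tb : env.TieBreak) (Φ : Demand V M) (η : Config V N) :
    env.cost Φ η (equitable tb η) = env.costInf Φ η := by
  rw [cost_equitable]
  simp_rw [costInf, iInf_service_eq tb]

/-- The one place where the sign of the demand matters: the best service cost bounds any other only
after multiplication by a nonnegative weight. -/
theorem costInf_le_cost_equitable (tb : env.TieBreak) {Φ : Demand V M} (hΦ : ∀ v j, 0 ≤ Φ v j)
    (η η' : Config V N) : env.costInf Φ η' ≤ env.cost Φ η' (equitable tb η) := by
  rw [cost_equitable]
  refine Finset.sum_le_sum fun j _ => Finset.sum_le_sum fun v _ => ?_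
  exact mul_le_mul_of_nonneg_right (ciInf_le (Set.finite_range _).bddBelow _) (hΦ v j)

theorem abs_cost_le {B : ℝ} (hB : ∀ i j x v, |env.service i j x v| ≤ B)
    (Φ : Demand V M) (η : Config V N) (P : Coverings V N M) :
    |env.cost Φ η P| ≤ N * B * demandNorm Φ := by
  have h1 : ∀ j i, |∑ v ∈ P j i, env.service i j (η i) v * Φ v j| ≤ B * ∑ v, |Φ v j| := by
    intro j i
    rw [Finset.mul_sum]
    refine (Finset.abs_sum_le_sum_abs _ _).trans ?_
    refine (Finset.sum_le_sum_of_subset_of_nonneg (Finset.subset_univ _)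
      fun _ _ _ => abs_nonneg _).trans (Finset.sum_le_sum fun v _ => ?_)
    rw [abs_mul]
    exact mul_le_mul_of_nonneg_right (hB _ _ _ _) (abs_nonneg _)
  refine (Finset.abs_sum_le_sum_abs _ _).trans ?_
  rw [demandNorm, Finset.mul_sum]
  refine Finset.sum_le_sum fun j _ => ?_
  refine (Finset.abs_sum_le_sum_abs _ _).trans ((Finset.sum_le_sum fun i _ => h1 j i).trans ?_)
  rw [Finset.sum_const, Finset.card_univ, Fintype.card_fin, nsmul_eq_mul, mul_assoc]

theorem abs_regret_le (tb : env.TieBreak) {B : ℝ} (hB : ∀ i j x v, |env.service i j x v| ≤ B)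
    (Φ : Demand V M) (η : Config V N) (P : Coverings V N M) :
    |regret tb Φ η P| ≤ 4 * N * B * demandNorm Φ := by
  have h1 := abs_le.1 (abs_cost_le hB Φ η P)
  have h2 := abs_le.1 (abs_cost_le hB Φ (env.centers Φ P) P)
  have h3 := abs_le.1 (abs_cost_le hB Φ η (equitable tb η))
  rw [regret, abs_le]
  constructor <;> linarith [h1.1, h1.2, h2.1, h2.2, h3.1, h3.2]

/-- The best robot depends on the configuration but not on the demand, so `H_inf` is linear in the
demand with coefficients bounded by `B`. -/
theorem abs_costInf_sub_le (tb : env.TieBreak) {B : ℝ}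
    (hB : ∀ i j x v, |env.service i j x v| ≤ B) (Φ Φ' : Demand V M) (η : Config V N) :
    |env.costInf Φ η - env.costInf Φ' η| ≤ B * demandNorm (Φ - Φ') := by
  simp_rw [costInf, iInf_service_eq tb]
  rw [← Finset.sum_sub_distrib, demandNorm, Finset.mul_sum]
  refine (Finset.abs_sum_le_sum_abs _ _).trans (Finset.sum_le_sum fun j _ => ?_)
  rw [← Finset.sum_sub_distrib, Finset.mul_sum]
  refine (Finset.abs_sum_le_sum_abs _ _).trans (Finset.sum_le_sum fun v _ => ?_)
  rw [← mul_sub, abs_mul]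
  exact mul_le_mul_of_nonneg_right (hB _ _ _ _) (abs_nonneg _)

/-- After convergence with the demand estimate `Φ'`, the regret for the true demand `Φ` is
controlled by the estimation error. -/
theorem abs_regret_le_of_isStable (tb : env.TieBreak) {B : ℝ}
    (hB : ∀ i j x v, |env.service i j x v| ≤ B) {Φ Φ' : Demand V M} (hΦ : ∀ v j, 0 ≤ Φ v j)
    {η : Config V N} (hst : env.IsStable Φ' η) :
    |regret tb Φ η (equitable tb η)| ≤ 2 * N * B * demandNorm (Φ - Φ') := by
  set P := equitable tb η with hP
  -- On the equitable partitions of `η` the regret collapses to `H(η, P) - H(c(P), P)`, which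
  -- decouples over the robots.
  have hreg : regret tb Φ η P = ∑ i, (env.robotCost Φ P i (η i) -
      env.robotCost Φ P i (env.centers Φ P i)) := by
    rw [regret, ← hP, Finset.sum_sub_distrib, ← cost_eq_sum_robotCost,
      ← cost_eq_sum_robotCost Φ (env.centers Φ P)]
    ring
  have hcen : env.IsCenters Φ P (env.centers Φ P) := (env.exists_isCenters Φ P).choose_spec
  have hi : ∀ i, env.robotCost Φ P i (η i) - env.robotCost Φ P i (env.centers Φ P i) ≤
      2 * B * demandNorm (Φ - Φ') := by
    intro i
    set x := env.centers Φ P i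
    -- With `P` fixed, recentring robot `i` gains at most the drop of `H_inf`, as cost and `H_inf`
    -- agree at `η`. Stability excludes a drop for `Φ'`, and two changes of demand yield the factor
    -- 2.
    have h1 := costInf_le_cost_equitable tb hΦ η (Function.update η i x)
    have h2 := cost_equitable_self tb Φ η
    rw [← hP] at h1 h2
    have h3 : env.cost Φ (Function.update η i x) P - env.cost Φ η P =
        env.robotCost Φ P i x - env.robotCost Φ P i (η i) := by
      rw [cost_eq_sum_robotCost, cost_eq_sum_robotCost, ← Finset.sum_sub_distrib,
        Finset.sum_eq_single i]
      · rw [Function.update_self]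
      · intro k _ hk; rw [Function.update_of_ne hk, sub_self]
      · simp
    have h4 := abs_le.1 (abs_costInf_sub_le tb hB Φ Φ' η)
    have h5 := abs_le.1 (abs_costInf_sub_le tb hB Φ Φ' (Function.update η i x))
    have h6 := hst i x
    linarith [h4.1, h4.2, h5.1, h5.2]
  rw [hreg, abs_of_nonneg (Finset.sum_nonneg fun i _ => sub_nonneg.2 (hcen i _))]
  refine (Finset.sum_le_sum fun i _ => hi i).trans (le_of_eq ?_)
  rw [Finset.sum_const, Finset.card_univ, Fintype.card_fin, nsmul_eq_mul]
  ring

end Regret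

end Environment

end MultitaskCoverage

/-! ### Regret accumulated over epochs -/

namespace MultitaskCoverage

open Environment

theorem sum_Ioc_le_of_le_of_late_le {g : ℕ → ℝ} {x y z K : ℕ} {a b : ℝ} (ha : 0 ≤ a) (hb : 0 ≤ b)
    (hga : ∀ t, g t ≤ a) (hgb : ∀ t, y + K ≤ t → t ≤ z → g t ≤ b) :
    ∑ t ∈ Finset.Ioc x z, g t ≤ (y + K - x : ℕ) * a + (z - y : ℕ) * b := by
  have h : ∀ t ∈ Finset.Ioc x z, g t ≤
      (if t ∈ Finset.Ioc x (y + K) then a else 0) + (if t ∈ Finset.Ioc y z then b else 0) := by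
    intro t ht
    rw [Finset.mem_Ioc] at ht
    by_cases h1 : t ≤ y + K
    · rw [if_pos (Finset.mem_Ioc.2 ⟨ht.1, h1⟩)]
      have : 0 ≤ if t ∈ Finset.Ioc y z then b else 0 := by split_ifs <;> simp [hb]
      linarith [hga t]
    · rw [if_neg (fun h => h1 (Finset.mem_Ioc.1 h).2), if_pos (Finset.mem_Ioc.2 ⟨by omega, ht.2⟩),
        zero_add]
      exact hgb t (by omega) ht.2
  refine (Finset.sum_le_sum h).trans ?_
  rw [Finset.sum_add_distrib, ← Finset.sum_filter, ← Finset.sum_filter, Finset.sum_const,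
    Finset.sum_const, nsmul_eq_mul, nsmul_eq_mul]
  have c1 : ((Finset.Ioc x z).filter fun t => t ∈ Finset.Ioc x (y + K)).card ≤ y + K - x := by
    rw [← Nat.card_Ioc]
    exact Finset.card_le_card fun t ht => (Finset.mem_filter.1 ht).2
  have c2 : ((Finset.Ioc x z).filter fun t => t ∈ Finset.Ioc y z).card ≤ z - y := by
    rw [← Nat.card_Ioc]
    exact Finset.card_le_card fun t ht => (Finset.mem_filter.1 ht).2
  gcongr

namespace DSMLCRun

variable {V : Type*} [Fintype V] [DecidableEq V] {N M : ℕ} {env : Environment V N M}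
  {tb : env.TieBreak} {l u ρ : ℕ} {β : ℝ} {s : ℕ → V} {n : ℕ → ℕ} {est : ℕ → Demand V M}

theorem tCov_le (r : DSMLCRun tb l u ρ β s n est) (ℓ : ℕ) :
    r.tCov ℓ ≤ r.tExp ℓ + ρ * (n (ℓ + 1) - n ℓ) + u := by
  have h1 : r.tCov ℓ ≤ r.tInf ℓ + u := (r.tCov_isLeast ℓ).2
    ⟨by omega, fun i => r.comm_federated.gap_le i (r.tInf ℓ)⟩
  have := r.tInf_le ℓ
  omega

theorem tExp_le_tCov (r : DSMLCRun tb l u ρ β s n est) (ℓ : ℕ) : r.tExp ℓ ≤ r.tCov ℓ :=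
  (r.tExp_le_tInf ℓ).trans (r.tCov_isLeast ℓ).1.1

/-- The number of slots at the start of an epoch, other than exploration slots, in which the team
need not be close to its final state. -/
def transient (V : Type*) [Fintype V] (N u : ℕ) : ℕ := u + (Fintype.card V ^ N + 3) * u

theorem sum_epoch_abs_regret_le (r : DSMLCRun tb l u ρ β s n est) {B : ℝ} (hB0 : 0 ≤ B)
    (hB : ∀ i j x v, |env.service i j x v| ≤ B) {Φ : Demand V M} (hΦ : ∀ v j, 0 ≤ Φ v j) (ℓ : ℕ) :
    ∑ t ∈ Finset.Ioc (r.tExp ℓ) (r.tExp (ℓ + 1)), |regret tb Φ (r.η t) (r.P t)| ≤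
      (ρ * (n (ℓ + 1) - n ℓ) + transient V N u : ℕ) * (4 * N * B * demandNorm Φ) +
      ⌈β ^ (ℓ + 1)⌉₊ * (2 * N * B * demandNorm (Φ - est (ℓ + 1))) := by
  have hn := demandNorm_nonneg Φ
  have hn' := demandNorm_nonneg (Φ - est (ℓ + 1))
  have hcard : Fintype.card (Config V N) = Fintype.card V ^ N := by
    rw [Fintype.card_fun, Fintype.card_fin]
  refine (sum_Ioc_le_of_le_of_late_le (y := r.tCov ℓ) (K := (Fintype.card V ^ N + 3) * u)
    (a := 4 * N * B * demandNorm Φ)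
    (b := 2 * N * B * demandNorm (Φ - est (ℓ + 1))) (by positivity) (by positivity)
    (fun t => abs_regret_le tb hB Φ _ _) fun t h1 h2 => ?_).trans ?_
  · obtain ⟨h3, h4⟩ := coverage_converges (r.coverage_step ℓ) r.comm_federated.gap_le
      (by rwa [hcard]) h2
    rw [h4]
    exact abs_regret_le_of_isStable tb hB hΦ h3
  · have h1 : r.tCov ℓ + (Fintype.card V ^ N + 3) * u - r.tExp ℓ ≤
        ρ * (n (ℓ + 1) - n ℓ) + transient V N u := by
      have := r.tCov_le ℓ
      unfold transient
      omega
    have h2 : r.tExp (ℓ + 1) - r.tCov ℓ = ⌈β ^ (ℓ + 1)⌉₊ := by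
      rw [r.tExp_succ]; omega
    rw [h2]
    gcongr

theorem sum_abs_regret_le (r : DSMLCRun tb l u ρ β s n est) {B : ℝ} (hB0 : 0 ≤ B)
    (hB : ∀ i j x v, |env.service i j x v| ≤ B) {Φ : Demand V M} (hΦ : ∀ v j, 0 ≤ Φ v j)
    (hn : Monotone n) (L : ℕ) :
    ∑ t ∈ Finset.Ioc 0 (r.tExp L), |regret tb Φ (r.η t) (r.P t)| ≤
      (ρ * n L + L * transient V N u : ℝ) * (4 * N * B * demandNorm Φ) +
      ∑ ℓ ∈ Finset.range L,
        ⌈β ^ (ℓ + 1)⌉₊ * (2 * N * B * demandNorm (Φ - est (ℓ + 1))) := by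
  induction L with
  | zero =>
    rw [r.tExp_zero]
    have := demandNorm_nonneg Φ
    simp only [Finset.Ioc_self, Finset.sum_empty, Finset.range_zero]
    positivity
  | succ L ih =>
    have hle : r.tExp L ≤ r.tExp (L + 1) := by
      rw [r.tExp_succ]; have := r.tExp_le_tCov L; omega
    rw [← Finset.sum_Ioc_consecutive _ (Nat.zero_le _) hle, Finset.sum_range_succ]
    have h := r.sum_epoch_abs_regret_le hB0 hB hΦ L
    have hc : ((ρ * (n (L + 1) - n L) + transient V N u : ℕ) : ℝ) =
        ρ * (n (L + 1) - n L) + transient V N u := by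
      push_cast [hn (Nat.le_succ L)]
      ring
    rw [hc] at h
    push_cast
    linarith

/-- The last coverage phase alone is this long. -/
theorem pow_le_tExp (r : DSMLCRun tb l u ρ β s n est) {L : ℕ} (hL : 1 ≤ L) :
    β ^ L ≤ r.tExp L := by
  obtain ⟨k, rfl⟩ : ∃ k, L = k + 1 := ⟨L - 1, by omega⟩
  rw [r.tExp_succ]
  push_cast
  linarith [Nat.le_ceil (β ^ (k + 1)), (Nat.cast_nonneg (r.tCov k) : (0 : ℝ) ≤ r.tCov k)]

end DSMLCRun

/-! ### Measurability of the regret -/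

section Measurability

theorem measurable_cost {V : Type*} [Countable V] {N M : ℕ} {env : Environment V N M}
    (η : Config V N) (P : Coverings V N M) :
    Measurable fun Φ : Demand V M => env.cost Φ η P := by
  unfold cost; fun_prop

variable {V : Type*} [Fintype V] {N M : ℕ} {env : Environment V N M}

/-- The chosen centers need not depend measurably on the demand, but their cost does: it is a sum of
minima of finitely many continuous functions. -/
theorem measurable_cost_centers (P : Coverings V N M) :
    Measurable fun Φ : Demand V M => env.cost Φ (env.centers Φ P) P := by
  have hne := env.connected.nonempty
  have h : (fun Φ : Demand V M => env.cost Φ (env.centers Φ P) P) =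
      fun Φ => ∑ i, Finset.univ.inf' Finset.univ_nonempty fun x => env.robotCost Φ P i x := by
    funext Φ
    rw [cost_eq_sum_robotCost]
    refine Finset.sum_congr rfl fun i _ => le_antisymm ?_ ?_
    · exact Finset.le_inf' _ _ fun x _ => (env.exists_isCenters Φ P).choose_spec i x
    · exact Finset.inf'_le _ (Finset.mem_univ _)
  rw [h]
  refine Finset.measurable_sum _ fun i _ => ?_
  refine (Continuous.finset_inf'_apply _ fun x _ => ?_).measurable
  unfold robotCost
  fun_prop

theorem measurable_regret (tb : env.TieBreak) (η : Config V N) (P : Coverings V N M) :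
    Measurable fun Φ : Demand V M => regret tb Φ η P := by
  unfold regret
  exact (((measurable_cost η P).const_mul 2).sub (measurable_cost_centers P)).sub
    (measurable_cost η _)

/-- Configurations and coverings take finitely many values, so the regret is a finite sum over
measurable events. -/
theorem aemeasurable_regret [DecidableEq V] (tb : env.TieBreak) {Ω : Type*} [MeasurableSpace Ω] {P : Measure Ω}
    {Φ : Ω → Demand V M} (hΦ : AEMeasurable Φ P) {η : Ω → Config V N} {Q : Ω → Coverings V N M}
    (hQ : ∀ x p, MeasurableSet {ω | η ω = x ∧ Q ω = p}) :
    AEMeasurable (fun ω => regret tb (Φ ω) (η ω) (Q ω)) P := by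
  have h : (fun ω => regret tb (Φ ω) (η ω) (Q ω)) = fun ω => ∑ x, ∑ p,
      Set.indicator {ω | η ω = x ∧ Q ω = p} (fun ω => regret tb (Φ ω) x p) ω := by
    funext ω
    rw [Finset.sum_eq_single (η ω), Finset.sum_eq_single (Q ω)]
    · simp
    · intro p _ hp; simp [hp.symm]
    · simp
    · intro x _ hx; simp [hx.symm]
    · simp
  rw [h]
  refine Finset.aemeasurable_fun_sum _ fun x _ => Finset.aemeasurable_fun_sum _ fun p _ => ?_
  exact ((measurable_regret tb x p).comp_aemeasurable hΦ).indicator (hQ x p)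

end Measurability

/-- Conditioning on an event multiplies the expectation of a nonnegative function at most by the
inverse of its probability. -/
theorem integral_cond_le {Ω : Type*} [MeasurableSpace Ω] {P : Measure Ω} (A : Set Ω)
    {f : Ω → ℝ} (hf : 0 ≤ f) (hint : Integrable f P) :
    ∫ ω, f ω ∂(cond P A) ≤ (P A)⁻¹.toReal * ∫ ω, f ω ∂P := by
  -- For a null event the factor is `∞`, whose `toReal` is `0`, and both sides vanish.
  rw [ProbabilityTheory.cond, integral_smul_measure, smul_eq_mul]
  exact mul_le_mul_of_nonneg_left
    (setIntegral_le_integral hint (.of_forall hf)) ENNReal.toReal_nonneg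

theorem integrable_cond {Ω : Type*} [MeasurableSpace Ω] {P : Measure Ω} (A : Set Ω)
    {f : Ω → ℝ} (hint : Integrable f P) : Integrable f (cond P A) := by
  by_cases h : P A = 0
  · rw [cond_eq_zero_of_meas_eq_zero h]
    exact integrable_zero_measure
  · exact (hint.restrict).smul_measure (ENNReal.inv_ne_top.2 h)

/-- The first moment is at most the root of the second. -/
theorem integral_abs_le_sqrt {Ω : Type*} [MeasurableSpace Ω] {P : Measure Ω}
    [IsProbabilityMeasure P] {f : Ω → ℝ} (hf : MemLp f 2 P) {c : ℝ}
    (hc : ∫ ω, f ω ^ 2 ∂P ≤ c) : ∫ ω, |f ω| ∂P ≤ √c := by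
  apply Real.le_sqrt_of_sq_le
  have h := variance_nonneg |f| P
  rw [variance_eq_sub hf.abs] at h
  simp only [Pi.pow_apply, Pi.abs_apply, sq_abs] at h
  linarith

end MultitaskCoverage

namespace MultitaskCoverage

open Environment

/-! ### From epochs to the horizon -/

section Growth

/-- Apply the hypothesis to the least `L` with `T ≤ β ^ L`; minimality gives `β ^ (L - 1) < T`, at
the price of one factor `β ^ (2/3)`. The logarithm is merely used to be at least `1`, as `T ≥ 3 >
e`. -/
theorem isBigO_of_epoch_bound {β C : ℝ} (hβ : 1 < β) {f : ℕ → ℝ} (hC : 0 ≤ C)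
    (h : ∀ T L : ℕ, 1 ≤ L → (T : ℝ) ≤ β ^ L → |f T| ≤ C * (β ^ (2 / 3 : ℝ)) ^ L) :
    f =O[Filter.atTop] fun T : ℕ => (T : ℝ) ^ (2 / 3 : ℝ) * Real.log T ^ 3 := by
  refine Asymptotics.IsBigO.of_bound (C * β ^ (2 / 3 : ℝ)) ?_
  filter_upwards [Filter.eventually_ge_atTop 3] with T hT
  have hT' : (3 : ℝ) ≤ T := by exact_mod_cast hT
  have hex : ∃ L : ℕ, (T : ℝ) ≤ β ^ L := (pow_unbounded_of_one_lt (T : ℝ) hβ).imp fun _ => le_of_lt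
  classical
  obtain ⟨k, hk⟩ : ∃ k, Nat.find hex = k + 1 := by
    refine ⟨Nat.find hex - 1, ?_⟩
    have : Nat.find hex ≠ 0 := fun h0 => by
      have := Nat.find_spec hex
      rw [h0, pow_zero] at this
      linarith
    omega
  have hmin : β ^ k < T := not_le.1 (Nat.find_min hex (by omega : k < Nat.find hex))
  have hspec := Nat.find_spec hex
  rw [hk] at hspec
  have h0 : 0 < β := by linarith
  have hlog : 1 ≤ Real.log T := by
    rw [Real.le_log_iff_exp_le (by linarith)]
    linarith [Real.exp_one_lt_d9]
  have hp : (β ^ (2 / 3 : ℝ)) ^ k ≤ (T : ℝ) ^ (2 / 3 : ℝ) := by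
    rw [← Real.rpow_natCast, ← Real.rpow_mul h0.le, mul_comm, Real.rpow_mul h0.le,
      Real.rpow_natCast]
    exact Real.rpow_le_rpow (by positivity) hmin.le (by norm_num)
  rw [Real.norm_eq_abs, Real.norm_of_nonneg (by positivity)]
  calc |f T| ≤ C * (β ^ (2 / 3 : ℝ)) ^ (k + 1) := h T (k + 1) (by omega) hspec
    _ = C * β ^ (2 / 3 : ℝ) * (β ^ (2 / 3 : ℝ)) ^ k := by ring
    _ ≤ C * β ^ (2 / 3 : ℝ) * (T : ℝ) ^ (2 / 3 : ℝ) := by gcongr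
    _ ≤ C * β ^ (2 / 3 : ℝ) * ((T : ℝ) ^ (2 / 3 : ℝ) * Real.log T ^ 3) := by
      gcongr
      exact le_mul_of_one_le_right (by positivity) (one_le_pow₀ hlog)

theorem natCast_le_pow_div {Q : ℝ} (hQ : 1 < Q) (L : ℕ) : (L : ℝ) ≤ (Q - 1)⁻¹ * Q ^ L := by
  rw [le_inv_mul_iff₀ (by linarith)]
  have := one_add_mul_le_pow (a := Q - 1) (by linarith) L
  rw [add_sub_cancel] at this
  linarith

theorem sum_pow_succ_le {Q : ℝ} (hQ : 1 < Q) (L : ℕ) :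
    ∑ ℓ ∈ Finset.range L, Q ^ (ℓ + 1) ≤ Q * (Q - 1)⁻¹ * Q ^ L := by
  have h : ∑ ℓ ∈ Finset.range L, Q ^ (ℓ + 1) = Q * ∑ ℓ ∈ Finset.range L, Q ^ ℓ := by
    rw [Finset.mul_sum]
    exact Finset.sum_congr rfl fun _ _ => pow_succ' _ _
  rw [h, geom_sum_eq hQ.ne', mul_assoc, div_eq_inv_mul]
  have : 0 < (Q - 1)⁻¹ := inv_pos.2 (by linarith)
  gcongr
  linarith

/-- The balance behind the exponent: with `Q = β ^ (2/3)` one has `α = Q⁻¹` and `β * √α = Q`, so the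
estimation cost grows at the same rate `Q ^ ℓ` as the number of samples `α ^ (-ℓ)`. -/
theorem ceil_pow_mul_sqrt_le {β α τ : ℝ} (hβ : 1 < β) (hα : α = β ^ (-(2 / 3) : ℝ)) (ℓ : ℕ) :
    ⌈β ^ ℓ⌉₊ * √(α ^ ℓ * τ) ≤ 2 * √τ * (β ^ (2 / 3 : ℝ)) ^ ℓ := by
  have h0 : 0 < β := by linarith
  set Q := β ^ (2 / 3 : ℝ) with hQ
  have hQ0 : 0 < Q := Real.rpow_pos_of_pos h0 _
  have hαQ : α = Q⁻¹ := by rw [hα, Real.rpow_neg h0.le]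
  have hβQ : β ^ 2 = Q ^ 3 := by
    rw [hQ, ← Real.rpow_natCast (β ^ (2 / 3 : ℝ)), ← Real.rpow_mul h0.le, ← Real.rpow_natCast]
    norm_num
  have h1 : (⌈β ^ ℓ⌉₊ : ℝ) ≤ 2 * β ^ ℓ := by
    have := Nat.ceil_lt_add_one (show 0 ≤ β ^ ℓ by positivity)
    linarith [one_le_pow₀ hβ.le (n := ℓ)]
  have h2 : β ^ ℓ * √(α ^ ℓ) = Q ^ ℓ := by
    rw [← Real.sqrt_sq (show 0 ≤ β ^ ℓ by positivity), ← Real.sqrt_mul (by positivity),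
      ← Real.sqrt_sq (show 0 ≤ Q ^ ℓ by positivity)]
    congr 1
    rw [← pow_mul, mul_comm ℓ 2, pow_mul, hβQ, hαQ, inv_pow, ← pow_mul]
    field_simp
    ring
  have hα0 : 0 ≤ α ^ ℓ := by rw [hαQ]; positivity
  calc ⌈β ^ ℓ⌉₊ * √(α ^ ℓ * τ) ≤ 2 * β ^ ℓ * √(α ^ ℓ * τ) := by gcongr
    _ = 2 * √τ * (β ^ ℓ * √(α ^ ℓ)) := by rw [Real.sqrt_mul hα0]; ring
    _ = _ := by rw [h2]

end Growth

end MultitaskCoverage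

/-! ### Expected regret and conclusion -/

namespace MultitaskCoverage

open Environment

theorem demandNorm_eq_sum_prod {V : Type*} [Fintype V] {M : ℕ} (Φ : Demand V M) :
    demandNorm Φ = ∑ p : V × Fin M, |Φ p.1 p.2| := by
  rw [demandNorm, Finset.sum_comm, Fintype.sum_prod_type]

theorem integrable_demandNorm {V Ω : Type*} [Fintype V] {M : ℕ} [MeasurableSpace Ω]
    {P : Measure Ω} [IsProbabilityMeasure P] {X : Ω → Demand V M}
    (hX : ∀ p : V × Fin M, MemLp (fun ω => X ω p.1 p.2) 2 P) :
    Integrable (fun ω => demandNorm (X ω)) P := by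
  simp_rw [demandNorm_eq_sum_prod]
  exact integrable_finsetSum _ fun p _ => ((hX p).integrable (by norm_num)).abs

theorem integral_demandNorm_le {V Ω : Type*} [Fintype V] {M : ℕ} [MeasurableSpace Ω]
    {P : Measure Ω} [IsProbabilityMeasure P] {X : Ω → Demand V M} {c : ℝ}
    (hX : ∀ p : V × Fin M, MemLp (fun ω => X ω p.1 p.2) 2 P)
    (hc : ∀ p : V × Fin M, ∫ ω, X ω p.1 p.2 ^ 2 ∂P ≤ c) :
    ∫ ω, demandNorm (X ω) ∂P ≤ Fintype.card (V × Fin M) * √c := by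
  simp_rw [demandNorm_eq_sum_prod]
  rw [integral_finsetSum _ fun p _ => ((hX p).integrable (by norm_num)).abs]
  refine (Finset.sum_le_sum fun p _ => integral_abs_le_sqrt (hX p) (hc p)).trans ?_
  rw [Finset.sum_const, nsmul_eq_mul, Finset.card_univ]

/-- The expected `ℓ¹` error of the posterior mean, in terms of the posterior variances. -/
theorem demand_error_bound {V : Type*} [Fintype V] [DecidableEq V] {M : ℕ}
    {S : Matrix (V × Fin M) (V × Fin M) ℝ} {σ : ℝ} (hS : S.PosSemidef) (hσ : 0 < σ)
    {Ω : Type*} [MeasurableSpace Ω] {P : Measure Ω} [IsProbabilityMeasure P]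
    {μ₀ : EuclideanSpace ℝ (V × Fin M)} {Φ : Ω → EuclideanSpace ℝ (V × Fin M)}
    (hΦ : HasLaw Φ (multivariateGaussian μ₀ S) P)
    {ε : ℕ → Ω → EuclideanSpace ℝ (Fin M)}
    (hε : ∀ k, HasLaw (ε k) (multivariateGaussian 0 (σ ^ 2 • (1 : Matrix (Fin M) (Fin M) ℝ))) P)
    (hε_indep : iIndepFun ε P) (hΦε_indep : IndepFun Φ (fun ω k => ε k ω) P)
    (s : ℕ → V) (k : ℕ) {c : ℝ} (hc : ∀ v, (block (postCov S σ s k) v).trace ≤ c) :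
    Integrable (fun ω => demandNorm ((fun v j => Φ ω (v, j)) -
      fun v j => postMean (fun p => μ₀ p) S σ s (fun m j' => Φ ω (s m, j') + ε m ω j') k (v, j)))
      P ∧
    ∫ ω, demandNorm ((fun v j => Φ ω (v, j)) -
      fun v j => postMean (fun p => μ₀ p) S σ s (fun m j' => Φ ω (s m, j') + ε m ω j') k (v, j))
      ∂P ≤ Fintype.card (V × Fin M) * √c := by
  have h := integral_sq_postMean_sub hS hσ hΦ hε hε_indep hΦε_indep s k
  have hmem : ∀ p : V × Fin M, MemLp (fun ω => ((fun v j => Φ ω (v, j)) - fun v j =>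
      postMean (fun p => μ₀ p) S σ s (fun m j' => Φ ω (s m, j') + ε m ω j') k (v, j)) p.1 p.2)
      2 P := fun p => by
    convert (h p).1.neg using 1
    funext ω
    simp
  refine ⟨integrable_demandNorm hmem, integral_demandNorm_le hmem fun p => ?_⟩
  refine le_trans (le_of_eq ?_) ((h p).2.le.trans (le_trans ?_ (hc p.1)))
  · refine integral_congr_ae (.of_forall fun ω => ?_)
    simp only [Pi.sub_apply]
    ring
  · rw [trace_block]
    exact Finset.single_le_sum (f := fun j => postCov S σ s k (p.1, j) (p.1, j))
      (fun j _ => (posSemidef_postCov hS σ s k).diag_nonneg) (Finset.mem_univ p.2)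

/-- The regret bound for runs whose demand estimates have expected errors `O(√(α ^ ℓ))`, obtained
from `O(α ^ (-ℓ))` samples. -/
theorem regret_bound {V : Type*} [Fintype V] [DecidableEq V] {N M : ℕ}
    {env : Environment V N M} {tb : env.TieBreak} {Ω : Type*} [MeasurableSpace Ω] {μ : Measure Ω}
    [IsProbabilityMeasure μ] {l u ρ : ℕ} {β α τ : ℝ} (hβ : 1 < β) (hα : α = β ^ (-(2 / 3) : ℝ))
    {s : ℕ → V} {n : ℕ → ℕ} {est : Ω → ℕ → Demand V M} {φ : Ω → Demand V M} {C₀ D : ℝ}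
    (hmono : Monotone n) (hC₀ : 0 ≤ C₀) (hcount : ∀ ℓ, (n ℓ : ℝ) ≤ C₀ * (α ^ ℓ)⁻¹)
    (hφmeas : AEMeasurable φ μ) (hφint : Integrable (fun ω => demandNorm (φ ω)) μ) (hD : 0 ≤ D)
    (herr : ∀ ℓ, Integrable (fun ω => demandNorm (φ ω - est ω ℓ)) μ ∧
      ∫ ω, demandNorm (φ ω - est ω ℓ) ∂μ ≤ D * √(α ^ ℓ * τ))
    (run : (ω : Ω) → DSMLCRun tb l u ρ β s n (est ω))
    (hrun : ∀ t x p, MeasurableSet {ω | (run ω).η t = x ∧ (run ω).P t = p}) :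
    (∀ T : ℕ, Integrable
      (fun ω => ∑ t ∈ Finset.Icc 1 T, regret tb (φ ω) ((run ω).η t) ((run ω).P t))
      (ProbabilityTheory.cond μ {ω | ∀ v j, 0 ≤ φ ω v j})) ∧
    (fun T : ℕ => ∫ ω, ∑ t ∈ Finset.Icc 1 T, regret tb (φ ω) ((run ω).η t) ((run ω).P t)
      ∂(ProbabilityTheory.cond μ {ω | ∀ v j, 0 ≤ φ ω v j}))
      =O[Filter.atTop] fun T : ℕ => (T : ℝ) ^ (2 / 3 : ℝ) * Real.log T ^ 3 := by
  have hβ0 : 0 < β := by linarith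
  obtain ⟨B, hB0, hB⟩ := env.exists_service_bound
  set A : Set Ω := {ω | ∀ v j, 0 ≤ φ ω v j} with hA
  have hAmeas : NullMeasurableSet A μ := by
    rw [hA, Set.ofPred_forall]
    refine .iInter fun v => ?_
    rw [Set.ofPred_forall]
    refine .iInter fun j => nullMeasurableSet_le aemeasurable_const ?_
    exact (measurable_pi_apply j).comp_aemeasurable
      ((measurable_pi_apply v).comp_aemeasurable hφmeas)
  set Q := β ^ (2 / 3 : ℝ) with hQ
  have hQ1 : 1 < Q := Real.one_lt_rpow hβ (by norm_num)
  have hαQ : α = Q⁻¹ := by rw [hα, Real.rpow_neg hβ0.le]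
  set F := ∫ ω, demandNorm (φ ω) ∂μ with hF
  have hF0 : 0 ≤ F := integral_nonneg fun ω => demandNorm_nonneg _
  -- a dominating function for the first `L` epochs
  set κ : ℝ := ((DSMLCRun.transient V N u : ℕ) : ℝ) with hκ
  set G : ℕ → Ω → ℝ := fun L ω =>
    (ρ * n L + L * κ) * (4 * N * B * demandNorm (φ ω)) +
      ∑ ℓ ∈ Finset.range L,
        ⌈β ^ (ℓ + 1)⌉₊ * (2 * N * B * demandNorm (φ ω - est ω (ℓ + 1))) with hG
  have hG0 : ∀ L, 0 ≤ G L := fun L ω => by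
    have h1 := demandNorm_nonneg (φ ω)
    have h2 := fun ℓ => demandNorm_nonneg (φ ω - est ω ℓ)
    refine add_nonneg (by positivity) (Finset.sum_nonneg fun ℓ _ => ?_)
    have := h2 (ℓ + 1)
    positivity
  have hGint : ∀ L, Integrable (G L) μ := fun L =>
    ((hφint.const_mul _).const_mul _).add
      (integrable_finsetSum _ fun ℓ _ => ((herr (ℓ + 1)).1.const_mul _).const_mul _)
  -- The first summand pays for exploration and the transients, with `L ≤ (Q - 1)⁻¹ * Q ^ L`; the
  -- second is the geometric sum of the estimation costs.
  set C : ℝ := (ρ * C₀ + (Q - 1)⁻¹ * κ) * (4 * N * B * F) +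
    2 * N * B * D * (2 * √τ) * (Q * (Q - 1)⁻¹) with hC
  have hQinv : 0 < (Q - 1)⁻¹ := inv_pos.2 (by linarith)
  have hC0 : 0 ≤ C := by positivity
  have hGle : ∀ L, ∫ ω, G L ω ∂μ ≤ C * Q ^ L := by
    intro L
    have h1 : ∫ ω, G L ω ∂μ = (ρ * n L + L * κ) * (4 * N * B * F) +
        ∑ ℓ ∈ Finset.range L,
          ⌈β ^ (ℓ + 1)⌉₊ * (2 * N * B * ∫ ω, demandNorm (φ ω - est ω (ℓ + 1)) ∂μ) := by
      simp only [hG]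
      rw [integral_add ((hφint.const_mul _).const_mul _)
        (integrable_finsetSum _ fun ℓ _ => ((herr (ℓ + 1)).1.const_mul _).const_mul _),
        integral_finsetSum _ fun ℓ _ => ((herr (ℓ + 1)).1.const_mul _).const_mul _,
        integral_const_mul, integral_const_mul]
      simp_rw [integral_const_mul, hF]
    have h2 : (n L : ℝ) ≤ C₀ * Q ^ L := by
      have := hcount L
      rwa [hαQ, inv_pow, inv_inv] at this
    have h3 := natCast_le_pow_div hQ1 L
    have h4 : ∀ ℓ ∈ Finset.range L, ⌈β ^ (ℓ + 1)⌉₊ *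
        (2 * N * B * ∫ ω, demandNorm (φ ω - est ω (ℓ + 1)) ∂μ) ≤
        2 * N * B * D * (2 * √τ) * Q ^ (ℓ + 1) := by
      intro ℓ _
      calc _ ≤ ⌈β ^ (ℓ + 1)⌉₊ * (2 * N * B * (D * √(α ^ (ℓ + 1) * τ))) := by
            gcongr
            exact (herr (ℓ + 1)).2
        _ = 2 * N * B * D * (⌈β ^ (ℓ + 1)⌉₊ * √(α ^ (ℓ + 1) * τ)) := by ring
        _ ≤ 2 * N * B * D * (2 * √τ * Q ^ (ℓ + 1)) := by
            exact mul_le_mul_of_nonneg_left (ceil_pow_mul_sqrt_le hβ hα (ℓ + 1)) (by positivity)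
        _ = _ := by ring
    rw [h1]
    calc _ ≤ (ρ * (C₀ * Q ^ L) + (Q - 1)⁻¹ * Q ^ L * κ) * (4 * N * B * F) +
          ∑ ℓ ∈ Finset.range L, 2 * N * B * D * (2 * √τ) * Q ^ (ℓ + 1) := by
          refine add_le_add ?_ (Finset.sum_le_sum h4)
          gcongr
      _ ≤ (ρ * (C₀ * Q ^ L) + (Q - 1)⁻¹ * Q ^ L * κ) * (4 * N * B * F) +
          2 * N * B * D * (2 * √τ) * (Q * (Q - 1)⁻¹ * Q ^ L) := by
          rw [← Finset.mul_sum]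
          gcongr
          exact sum_pow_succ_le hQ1 L
      _ = C * Q ^ L := by rw [hC]; ring
  -- The first `L` epochs contain all slots up to `T` for every outcome, and absolute values allow
  -- the sum to be extended to their end.
  have hdom : ∀ T L : ℕ, 1 ≤ L → (T : ℝ) ≤ β ^ L → ∀ ω ∈ A,
      |∑ t ∈ Finset.Icc 1 T, regret tb (φ ω) ((run ω).η t) ((run ω).P t)| ≤ G L ω := by
    intro T L hL hT ω hω
    have hTL : T ≤ (run ω).tExp L := by exact_mod_cast hT.trans ((run ω).pow_le_tExp hL)
    refine (Finset.abs_sum_le_sum_abs _ _).trans (le_trans ?_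
      ((run ω).sum_abs_regret_le hB0 hB (Φ := φ ω) hω hmono L))
    refine Finset.sum_le_sum_of_subset_of_nonneg (fun t ht => ?_) fun _ _ _ => abs_nonneg _
    rw [Finset.mem_Icc] at ht
    exact Finset.mem_Ioc.2 ⟨by omega, ht.2.trans hTL⟩
  have hae : ∀ T L : ℕ, 1 ≤ L → (T : ℝ) ≤ β ^ L → ∀ᵐ ω ∂(ProbabilityTheory.cond μ A),
      ‖∑ t ∈ Finset.Icc 1 T, regret tb (φ ω) ((run ω).η t) ((run ω).P t)‖ ≤ G L ω := by
    intro T L hL hT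
    filter_upwards [ae_cond_mem₀ hAmeas] with ω hω using hdom T L hL hT ω hω
  have hmeas : ∀ T : ℕ, AEStronglyMeasurable
      (fun ω => ∑ t ∈ Finset.Icc 1 T, regret tb (φ ω) ((run ω).η t) ((run ω).P t))
      (ProbabilityTheory.cond μ A) := fun T =>
    ((Finset.aemeasurable_fun_sum _ fun t _ => aemeasurable_regret tb hφmeas
      (hrun t)).mono_ac cond_absolutelyContinuous).aestronglyMeasurable
  refine ⟨fun T => ?_, isBigO_of_epoch_bound hβ (C := (μ A)⁻¹.toReal * C) (by positivity)
    fun T L hL hT => ?_⟩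
  -- The index is raised to `L + 1` because the domination needs at least one epoch.
  · obtain ⟨L, hL⟩ := pow_unbounded_of_one_lt (T : ℝ) hβ
    exact (integrable_cond A (hGint (L + 1))).mono' (hmeas T) (hae T (L + 1) (by omega)
      (hL.le.trans (pow_le_pow_right₀ hβ.le (Nat.le_succ L))))
  · calc _ ≤ ∫ ω, G L ω ∂(ProbabilityTheory.cond μ A) :=
          norm_integral_le_of_norm_le (integrable_cond A (hGint L)) (hae T L hL hT)
      _ ≤ (μ A)⁻¹.toReal * ∫ ω, G L ω ∂μ := integral_cond_le A (hG0 L) (hGint L)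
      _ ≤ (μ A)⁻¹.toReal * (C * Q ^ L) := by
          gcongr
          exact hGle L
      _ = _ := by ring

end MultitaskCoverage

theorem mainTheorem1
    {V : Type*} [Fintype V] [DecidableEq V] {N M : ℕ} [NeZero N]
    (env : Environment V N M) (tb : env.TieBreak)
    -- squared-exponential prior, positive semidefinite inter-task covariance
    (D : Set (EuclideanSpace ℝ (Fin 2))) (hD_convex : Convex ℝ D) (hD_compact : IsCompact D)
    (pos : V → EuclideanSpace ℝ (Fin 2)) (hpos : ∀ v, pos v ∈ D)
    (σv len σ : ℝ) (hσv : 0 < σv) (hlen : 0 < len) (hσ : 0 < σ)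
    (K : Matrix (Fin M) (Fin M) ℝ) (hK : K.PosSemidef)
    (μ₀ : EuclideanSpace ℝ (V × Fin M))
    (S : Matrix (V × Fin M) (V × Fin M) ℝ)
    (hS : S = Matrix.kronecker (seKernel pos σv len) K)
    -- demand and observation noise
    {Ω : Type*} [MeasurableSpace Ω] (μ : Measure Ω)
    [IsProbabilityMeasure μ]
    (Φ : Ω → EuclideanSpace ℝ (V × Fin M))
    (hΦ : HasLaw Φ (multivariateGaussian μ₀ S) μ)
    (ε : ℕ → Ω → EuclideanSpace ℝ (Fin M))
    (hε : ∀ k, HasLaw (ε k)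
      (multivariateGaussian 0 (σ ^ 2 • (1 : Matrix (Fin M) (Fin M) ℝ))) μ)
    (hε_indep : iIndepFun ε μ)
    (hΦε_indep : IndepFun Φ (fun ω k => ε k ω) μ)
    -- parameters of the algorithm
    (β α τ : ℝ) (hβ : 1 < β) (hα : α = β ^ (-(2 / 3) : ℝ))
    (hτ : ∀ v, (block S v).trace ≤ τ)
    (s : ℕ → V) (hs : IsGreedy S σ s)
    (l u ρ : ℕ)
    -- a run of the algorithm for every outcome
    (run : (ω : Ω) → DSMLCRun tb l u ρ β s
      (sampleTotal S σ s α τ)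
      (fun ℓ v j => postMean (fun p => μ₀ p) S σ s
        (fun m j' => Φ ω (s m, j') + ε m ω j')
        (sampleTotal S σ s α τ ℓ) (v, j)))
    (hrun : ∀ t x p, MeasurableSet {ω | (run ω).η t = x ∧ (run ω).P t = p}) :
    (∀ T : ℕ, Integrable
      (fun ω => ∑ t ∈ Finset.Icc 1 T, Environment.regret tb
        (fun v j => Φ ω (v, j)) ((run ω).η t) ((run ω).P t))
      (cond μ {ω | ∀ v j, 0 ≤ Φ ω (v, j)})) ∧
    (fun T : ℕ => ∫ ω, ∑ t ∈ Finset.Icc 1 T, Environment.regret tb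
        (fun v j => Φ ω (v, j)) ((run ω).η t) ((run ω).P t)
      ∂(cond μ {ω | ∀ v j, 0 ≤ Φ ω (v, j)}))
      =O[Filter.atTop] fun T : ℕ => (T : ℝ) ^ (2 / 3 : ℝ) * Real.log T ^ 3 := by
  have hV : Nonempty V := env.connected.nonempty
  have hSpsd : S.PosSemidef := hS ▸ (posSemidef_seKernel pos σv len hlen).kronecker hK
  have hβ0 : 0 < β := by linarith
  have hα0 : 0 < α := hα ▸ Real.rpow_pos_of_pos hβ0 _
  have hα1 : α < 1 := hα ▸ Real.rpow_lt_one_of_one_lt_of_neg hβ (by norm_num)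
  obtain ⟨hmono, htrace, C₀, hC₀, hcount⟩ := sampleTotal_bounds hSpsd hσ hs hα0 hα1 hτ
  have hΦp : ∀ p : V × Fin M, MemLp (fun ω => Φ ω p) 2 μ := fun p => by
    simpa using (gaussian_linear_moments hSpsd hΦ (Pi.single p 1)).1
  refine regret_bound hβ hα (D := Fintype.card (V × Fin M)) (τ := τ) hmono hC₀ hcount
    (φ := fun ω v j => Φ ω (v, j)) ?_ (integrable_demandNorm hΦp) (Nat.cast_nonneg _)
    (fun ℓ => ?_) run hrun
  · exact aemeasurable_pi_lambda _ fun v => aemeasurable_pi_lambda _ fun j =>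
      (hΦp (v, j)).aemeasurable
  · exact demand_error_bound hSpsd hσ hΦ hε hε_indep hΦε_indep s _ (htrace ℓ)
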